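/- Let $d\ge 1$, let $\Omega\subset\mathbb{R}^d$ be a bounded open set, $T>0$, $Q=\Omega\times(0,T]$, and let $\mathbf g\in\mathbb{R}^d$ be a constant vector. Let $(\cdot,\cdot)$ and $\|\cdot\|$ be the inner product and norm of $L^2(\Omega)$, let $H^1_0(\Omega)$ be the closure of $C_c^\infty(\Omega)$ in $H^1(\Omega)$, with dual $H^{-1}(\Omega)$ and duality pairing $\langle\cdot,\cdot\rangle$, and let $\mathcal W=\{u\in L^2(0,T;H^1_0(\Omega)) : \partial_t u\in L^2(0,T;H^{-1}(\Omega))\}$, whose elements are continuous in time with values in $L^2(\Omega)$. Assume the following. 1. $p^{(i)}_c,p^{(d)}_c:(0,1]\to\mathbb{R}$ are continuous, of class $C^1$ on $(0,1)$ with ${p^{(i)}_c}',{p^{(d)}_c}'<0$ and $p^{(d)}_c>p^{(i)}_c$ on $(0,1)$, $p^{(i)}_c(1)=p^{(d)}_c(1)$, and $p^{(j)}_c(S)\to\infty$ as $S\searrow0$, $-{p^{(j)}_c}'(S)\to\infty$ as $S\nearrow 1$ for $j\in\{i,d\}$. 2. $k\in C^1(\mathbb{R})$, $k(S)=k(0)\ge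 0$ for $S\le 0$, $k(S)=k(1)$ for $S\ge 1$, and $k(0)<k(S)<k(1)$ for $0<S<1$. Moreover $k(0)>0$ or $\mathbf g=0$. 3. $b\in C^1(\mathbb{R})$, $b(0)=0$, $b'\ge 0$ on $\mathbb{R}$, $\sup_{\mathbb{R}}b'<\infty$, and $0<b'(p^{(j)}_c(S))<-1/{p^{(j)}_c}'(S)$ for all $0<S<1$ and $j\in\{i,d\}$. 4. $S_0\in H^1(\Omega)$, $p_0\in H^1_0(\Omega)$, and there is $\epsilon>0$ with $\epsilon\le S_0\le 1-\epsilon$ and $p^{(i)}_c(S_0)\le p_0\le p^{(d)}_c(S_0)$ a.e. in $\Omega$. Put $U_M=V_m=\lim_{p\to\infty}b(p)$ (a finite limit), $U_m=b(p^{(i)}_c(1))$, $V_M=1+U_m$. For $j\in\{i,d\}$ and $V_m<v<V_M$ let $\rho^{(j)}(v)=b(p^{(j)}_c(S))$, where $S\in(0,1)$ is the unique solution of $S+b(p^{(j)}_c(S))=v$; let $\rho^{(j)}(v)=U_M$ for $v\le V_m$ and $\rho^{(j)}(v)=U_m$ for $v\ge V_M$. For $\tau>0$ let $$\Phi_\tau(u,v)=\frac1\tau\begin{cases}\rho^{(d)}(v)-u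 & \text{if } u>\rho^{(d)}(v),\\ 0 & \text{if } \rho^{(i)}(v)\le u\le\rho^{(d)}(v),\\ \rho^{(i)}(v)-u & \text{if } u<\rho^{(i)}(v).\end{cases}$$ A weak solution for the parameter $\tau$ is a pair $(S,p)$ with $p\in\mathcal W$, $S-S_0\in\mathcal W$, $S\in[0,1]$ a.e. in $Q$, $p(0)=p_0$, $S(0)=S_0$, $\partial_t(S+b(p))\in L^2(Q)$, and $$\int_0^T\langle\partial_tS,\phi\rangle=\int_0^T(k(S)[\nabla p-\mathbf g],\nabla\phi),\qquad \int_0^T(\partial_t(S+b(p)),\xi)=\int_0^T(\Phi_\tau(b(p),S+b(p)),\xi)$$ for all $\phi\in L^2(0,T;H^1_0(\Omega))$ and $\xi\in L^2(Q)$. Then: (i) There is a constant $C$ such that for every $\tau>0$ and every weak solution $(S_\tau,p_\tau)$ for $\tau$, the function $u_\tau:=b(p_\tau)$ lies in $L^2(0,T;H^1_0(\Omega))\cap L^\infty(0,T;L^2(\Omega))$ with $\|u_\tau\|_{L^2(0,T;H^1_0(\Omega))}\le C$ and $\|u_\tau\|_{L^\infty(0,T;L^2(\Omega))}\le C$. (ii)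 For every sequence $\tau_n>0$ with $\tau_n\to0$ and all weak solutions $(S_{\tau_n},p_{\tau_n})$ for $\tau_n$, there are a subsequence $(\tau_{n_m})_m$ and $u\in L^2(0,T;H^1_0(\Omega))\cap L^\infty(0,T;L^2(\Omega))$ such that $u_{\tau_{n_m}}=b(p_{\tau_{n_m}})\rightharpoonup u$ weakly in $L^2(0,T;H^1_0(\Omega))$ as $m\to\infty$. -/

import Mathlib

open MeasureTheory Filter Set
open scoped Topology ENNReal ContDiff

noncomputable section

/-! ### Function spaces on a bounded open set of `ℝ^d` and on the time interval `(0, T)` -/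

/-- Euclidean space `ℝ^d`. -/
abbrev EPHSpace (d : ℕ) : Type := EuclideanSpace ℝ (Fin d)

/-- `L²(Ω)`. -/
abbrev EPHL2 {d : ℕ} (Ω : Set (EPHSpace d)) : Type := Lp ℝ 2 (volume.restrict Ω)

/-- `L²(Ω; ℝ^d)`. -/
abbrev EPHL2Vec {d : ℕ} (Ω : Set (EPHSpace d)) : Type :=
  Lp (EPHSpace d) 2 (volume.restrict Ω)

/-- The Hilbert space `L²(Ω) × L²(Ω; ℝ^d)` of pairs (function, gradient field),
with the norm `(‖f‖² + ‖G‖²)^{1/2}`. -/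
abbrev EPHPair {d : ℕ} (Ω : Set (EPHSpace d)) : Type := WithLp 2 (EPHL2 Ω × EPHL2Vec Ω)

/-- Test functions `C_c^∞(Ω)`. -/
def IsTestFunction {d : ℕ} (Ω : Set (EPHSpace d)) (φ : EPHSpace d → ℝ) : Prop :=
  ContDiff ℝ ∞ φ ∧ HasCompactSupport φ ∧ tsupport φ ⊆ Ω

/-- `H¹₀(Ω)`, the closure of `C_c^∞(Ω)` in the `H¹(Ω)` norm `(‖u‖² + ‖∇u‖²)^{1/2}`.
An element is stored as the pair `(u, ∇u)`.  For a bounded `C¹` domain these are exactly the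
`H¹` functions with zero trace. -/
def H10Submodule {d : ℕ} (Ω : Set (EPHSpace d)) : Submodule ℝ (EPHPair Ω) :=
  (Submodule.span ℝ {w : EPHPair Ω | ∃ φ : EPHSpace d → ℝ, IsTestFunction Ω φ ∧
    (w.fst : EPHSpace d → ℝ) =ᵐ[volume.restrict Ω] φ ∧
    (w.snd : EPHSpace d → EPHSpace d) =ᵐ[volume.restrict Ω] gradient φ}).topologicalClosure

/-- `H¹₀(Ω)` as a Hilbert space. -/
abbrev H10 {d : ℕ} (Ω : Set (EPHSpace d)) : Type := H10Submodule Ω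

/-- The function underlying an element of `H¹₀(Ω)`. -/
def H10.fn {d : ℕ} {Ω : Set (EPHSpace d)} (w : H10 Ω) : EPHL2 Ω := (w : EPHPair Ω).fst

/-- The weak gradient of an element of `H¹₀(Ω)`. -/
def H10.grad {d : ℕ} {Ω : Set (EPHSpace d)} (w : H10 Ω) : EPHL2Vec Ω := (w : EPHPair Ω).snd

/-- `f ∈ H¹(Ω)`: the function `f ∈ L²(Ω)` has a weak gradient in `L²(Ω; ℝ^d)`. -/
def MemH1 {d : ℕ} (Ω : Set (EPHSpace d)) (f : EPHL2 Ω) : Prop :=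
  ∃ G : EPHL2Vec Ω, ∀ φ : EPHSpace d → ℝ, IsTestFunction Ω φ → ∀ j : Fin d,
    ∫ x in Ω, f x * (gradient φ x) j = -∫ x in Ω, (G x) j * φ x

/-- `H^{-1}(Ω)`, the dual of `H¹₀(Ω)`. -/
abbrev HMinus1 {d : ℕ} (Ω : Set (EPHSpace d)) : Type := StrongDual ℝ (H10 Ω)

/-- Lebesgue measure on the time interval. -/
abbrev timeMeasure (T : ℝ) : Measure ℝ := volume.restrict (Ioc 0 T)

/-- The Bochner space `L²(0,T;X)`. -/
abbrev L2Time (T : ℝ) (X : Type) [NormedAddCommGroup X] : Type := Lp X 2 (timeMeasure T)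

/-- Test functions `C_c^∞(0,T)` in time. -/
def IsTimeTest (T : ℝ) (η : ℝ → ℝ) : Prop :=
  ContDiff ℝ ∞ η ∧ HasCompactSupport η ∧ tsupport η ⊆ Ioo 0 T

/-- `w ∈ L²(0,T;H^{-1}(Ω))` is the weak time derivative of `u ∈ L²(0,T;H¹₀(Ω))`, where
`L²(Ω)` is identified with a subspace of `H^{-1}(Ω)` through the `L²` inner product. -/
def HasTimeDerivHMinus1 {d : ℕ} {Ω : Set (EPHSpace d)} {T : ℝ}
    (u : L2Time T (H10 Ω)) (w : L2Time T (HMinus1 Ω)) : Prop :=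
  ∀ η : ℝ → ℝ, IsTimeTest T η → ∀ φ : H10 Ω,
    ∫ t in Ioc 0 T, deriv η t * inner ℝ (H10.fn (u t)) (H10.fn φ)
      = -∫ t in Ioc 0 T, η t * (w t) φ

/-- The space `𝒲 = {u ∈ L²(0,T;H¹₀(Ω)) : ∂ₜu ∈ L²(0,T;H^{-1}(Ω))}`. -/
def MemW {d : ℕ} {Ω : Set (EPHSpace d)} {T : ℝ} (u : L2Time T (H10 Ω)) : Prop :=
  ∃ w : L2Time T (HMinus1 Ω), HasTimeDerivHMinus1 u w

/-- `w ∈ L²(Q) = L²(0,T;L²(Ω))` is the weak time derivative of `v ∈ L²(0,T;L²(Ω))`. -/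
def HasTimeDerivL2 {d : ℕ} {Ω : Set (EPHSpace d)} {T : ℝ}
    (v w : L2Time T (EPHL2 Ω)) : Prop :=
  ∀ η : ℝ → ℝ, IsTimeTest T η →
    ∫ t in Ioc 0 T, deriv η t • v t = -∫ t in Ioc 0 T, η t • w t

/-- `u(0) = u₀`, read through the representative of `u` in `C([0,T];L²(Ω))`. -/
def HasInitialValue {d : ℕ} {Ω : Set (EPHSpace d)} (T : ℝ) (u : ℝ → EPHL2 Ω)
    (u₀ : EPHL2 Ω) : Prop :=
  ∃ c : ℝ → EPHL2 Ω, ContinuousOn c (Icc 0 T) ∧ (∀ᵐ t ∂timeMeasure T, c t = u t) ∧ c 0 = u₀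

/-! ### Constitutive functions -/

/-- Assumptions on the imbibition and drainage capillary pressure curves on `(0,1]`. -/
structure CapillaryCurves (pcI pcD : ℝ → ℝ) : Prop where
  contDiffI : ContDiffOn ℝ 1 pcI (Ioo 0 1)
  contDiffD : ContDiffOn ℝ 1 pcD (Ioo 0 1)
  contI : ContinuousOn pcI (Ioc 0 1)
  contD : ContinuousOn pcD (Ioc 0 1)
  derivI_neg : ∀ S ∈ Ioo (0 : ℝ) 1, deriv pcI S < 0
  derivD_neg : ∀ S ∈ Ioo (0 : ℝ) 1, deriv pcD S < 0
  lt : ∀ S ∈ Ioo (0 : ℝ) 1, pcI S < pcD S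
  eq_one : pcI 1 = pcD 1
  blowupI : Tendsto pcI (𝓝[>] 0) atTop
  blowupD : Tendsto pcD (𝓝[>] 0) atTop
  steepI : Tendsto (fun S => -deriv pcI S) (𝓝[<] 1) atTop
  steepD : Tendsto (fun S => -deriv pcD S) (𝓝[<] 1) atTop

/-- Assumptions on the relative permeability. -/
structure Permeability (k : ℝ → ℝ) : Prop where
  contDiff : ContDiff ℝ 1 k
  nonneg : 0 ≤ k 0
  left : ∀ S ≤ 0, k S = k 0
  right : ∀ S, 1 ≤ S → k S = k 1
  between : ∀ S ∈ Ioo (0 : ℝ) 1, k 0 < k S ∧ k S < k 1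

/-- Assumptions on the function `b` that determines the scanning curves
`S + b(p) = constant`. -/
structure ScanningFunction (pcI pcD b : ℝ → ℝ) : Prop where
  contDiff : ContDiff ℝ 1 b
  zero : b 0 = 0
  boundI : ∀ S ∈ Ioo (0 : ℝ) 1, 0 < deriv b (pcI S) ∧ deriv b (pcI S) < -1 / deriv pcI S
  boundD : ∀ S ∈ Ioo (0 : ℝ) 1, 0 < deriv b (pcD S) ∧ deriv b (pcD S) < -1 / deriv pcD S
  deriv_nonneg : ∀ p, 0 ≤ deriv b p
  deriv_bdd : ∃ bM : ℝ, ∀ p, deriv b p ≤ bM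

/-- `b(∞)`, the common value of `U_M` and `V_m`. -/
def bInfty (b : ℝ → ℝ) : ℝ := limUnder atTop b

/-- For a capillary curve `pc` (imbibition or drainage), the curve `p = pc(S)` in the variables
`u = b(p)`, `v = S + b(p)`, written as a graph `u = ρ(v)`.  For `V_m < v < V_M`, with
`V_m = b(∞)` and `V_M = 1 + b(pc(1))`, let `S ∈ (0,1)` be the solution of `S + b(pc(S)) = v`;
then `ρ(v) = b(pc(S))`, that is, `ρ` is the inverse of `u ↦ pc⁻¹(b⁻¹(u)) + u`.  It is extended
by `U_M = b(∞)` to `v ≤ V_m` and by `U_m = b(pc(1))` to `v ≥ V_M`. -/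
def rho (b pc : ℝ → ℝ) (v : ℝ) : ℝ :=
  if v ≤ bInfty b then bInfty b
  else if 1 + b (pc 1) ≤ v then b (pc 1)
  else b (pc (Function.invFunOn (fun S => S + b (pc S)) (Ioo 0 1) v))

/-- The regularised hysteresis relation `Φ_τ(u,v)`. -/
def PhiTau (pcI pcD b : ℝ → ℝ) (τ u v : ℝ) : ℝ :=
  (1 / τ) *
    (if rho b pcD v < u then rho b pcD v - u
     else if u < rho b pcI v then rho b pcI v - u
     else 0)

/-- Assumptions on the initial data `S₀ ∈ H¹(Ω)`, `p₀ ∈ H¹₀(Ω)`. -/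
structure InitialData {d : ℕ} {Ω : Set (EPHSpace d)} (pcI pcD : ℝ → ℝ)
    (S₀ : EPHL2 Ω) (p₀ : H10 Ω) : Prop where
  memH1 : MemH1 Ω S₀
  away : ∃ ε > 0, ∀ᵐ x ∂volume.restrict Ω, ε ≤ S₀ x ∧ S₀ x ≤ 1 - ε
  between : ∀ᵐ x ∂volume.restrict Ω, pcI (S₀ x) ≤ H10.fn p₀ x ∧ H10.fn p₀ x ≤ pcD (S₀ x)

/-! ### Weak solutions of the regularised extended play-type hysteresis model -/

/-- `(S, p)` is a weak solution of the model with regularisation parameter `τ`: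
`p ∈ 𝒲`, `S - S₀ ∈ 𝒲` (this difference is `Z`, and `∂ₜS = ∂ₜZ` is `dS`), `S ∈ [0,1]` a.e.,
`p(0) = p₀`, `S(0) = S₀`,
`∫₀ᵀ ⟨∂ₜS, φ⟩ = ∫₀ᵀ (k(S)[∇p - g], ∇φ)` for all `φ ∈ L²(0,T;H¹₀(Ω))`, and
`∫₀ᵀ (∂ₜ(S + b(p)), ξ) = ∫₀ᵀ (Φ_τ(b(p), S + b(p)), ξ)` for all `ξ ∈ L²(Q)`;
the function `S + b(p)` is called `v` and its time derivative `dv`. -/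
def IsEPHWeakSolution {d : ℕ} {Ω : Set (EPHSpace d)} {T : ℝ} (pcI pcD k b : ℝ → ℝ)
    (g : EPHSpace d) (S₀ : EPHL2 Ω) (p₀ : H10 Ω) (τ : ℝ)
    (S : L2Time T (EPHL2 Ω)) (p : L2Time T (H10 Ω)) : Prop :=
  MemW p ∧
  HasInitialValue T (fun t => H10.fn (p t)) (H10.fn p₀) ∧
  HasInitialValue T (fun t => S t) S₀ ∧
  (∀ᵐ t ∂timeMeasure T, ∀ᵐ x ∂volume.restrict Ω, 0 ≤ S t x ∧ S t x ≤ 1) ∧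
  (∃ (Z : L2Time T (H10 Ω)) (dS : L2Time T (HMinus1 Ω)),
    (∀ᵐ t ∂timeMeasure T, S t - S₀ = H10.fn (Z t)) ∧
    HasTimeDerivHMinus1 Z dS ∧
    ∀ φ : L2Time T (H10 Ω),
      ∫ t in Ioc 0 T, (dS t) (φ t)
        = ∫ t in Ioc 0 T, ∫ x in Ω,
            inner ℝ (k (S t x) • (H10.grad (p t) x - g)) (H10.grad (φ t) x)) ∧
  (∃ v dv : L2Time T (EPHL2 Ω),
    (∀ᵐ t ∂timeMeasure T, ∀ᵐ x ∂volume.restrict Ω, v t x = S t x + b (H10.fn (p t) x)) ∧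
    HasTimeDerivL2 v dv ∧
    ∀ ξ : L2Time T (EPHL2 Ω),
      ∫ t in Ioc 0 T, ∫ x in Ω, dv t x * ξ t x
        = ∫ t in Ioc 0 T, ∫ x in Ω,
            PhiTau pcI pcD b τ (b (H10.fn (p t) x)) (v t x) * ξ t x)

/-- The element `u` of `L²(0,T;H¹₀(Ω))` is the function `b(p)`. -/
def IsBOf {d : ℕ} {Ω : Set (EPHSpace d)} {T : ℝ} (b : ℝ → ℝ)
    (p u : L2Time T (H10 Ω)) : Prop :=
  ∀ᵐ t ∂timeMeasure T, ∀ᵐ x ∂volume.restrict Ω, H10.fn (u t) x = b (H10.fn (p t) x)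

end

noncomputable section

/-! Write `u = b(p)` and `v = S + u`, and let `ρ(v)` be the drainage branch `ρ^{(d)}(v)`. For a
nondecreasing `ψ` with `ψ(0) = 0`, test the `S`-equation with `ψ(u)` and the `v`-equation with
`ψ(u) - ψ(ρ(v))`. Since `Φ_τ(u, v)` pushes `u` towards the hysteresis loop, whose upper end is
`ρ(v)`, the product `Φ_τ(u, v) (ψ(u) - ψ(ρ(v)))` is nonpositive whatever `τ` is. As `u = v - S`, the
difference of the two identities is the entropy inequality
`∫ Ψ(u(s)) + ∫₀ˢ (k(S)(∇p - g), ∇ψ(u)) ≤ ∫ R(v(s)) + (initial terms)`, where `Ψ' = ψ`,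
`R' = ψ ∘ ρ`, and no `τ` appears; `Ψ` and `-R` are convex because `ψ` is increasing and `ρ` is
decreasing, so the time derivatives, which are mere functionals, can be integrated.

If `g = 0` and `k(0) = 0`, taking for `ψ` a truncation above `b(p_c^{(d)}(s))` with small `s > 0`
shows that the saturation never drops below `s`, so in every case `k(S) ≥ κ > 0` with `κ`
independent of `τ`. Then `ψ(u) = u` controls `‖u‖` in `L^∞(0,T;L²)` and `‖∇u‖` in `L²(Q)`, as
`∇u = b'(p) ∇p` and `ρ` is bounded. Weak sequential compactness of balls in the Hilbert space
`L²(0,T;H¹₀)` gives the limit, which inherits the `L^∞` bound because closed convex sets are weakly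
closed. -/

lemma hasDerivAt_nonneg_of_nonneg_right {P : ℝ → ℝ} {a δ P' : ℝ} (hP : HasDerivAt P P' a)
    (ha : P a = 0) (hδ : 0 < δ) (hpos : ∀ x ∈ Ioo a (a + δ), 0 ≤ P x) : 0 ≤ P' := by
  have hslope : Tendsto (slope P a) (𝓝[>] a) (𝓝 P') :=
    (hasDerivAt_iff_tendsto_slope.1 hP).mono_left (nhdsGT_le_nhdsNE a)
  refine ge_of_tendsto hslope ?_
  filter_upwards [Ioo_mem_nhdsGT (lt_add_of_pos_right a hδ)] with x hx
  rw [slope_def_field, ha, sub_zero]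
  exact div_nonneg (hpos x hx) (sub_nonneg.2 hx.1.le)

section Energy

variable {V : Type*} [NormedAddCommGroup V] [NormedSpace ℝ V]

lemma continuous_integral_translate_pairing {D : ℝ → StrongDual ℝ V} {w : ℝ → V}
    (hD : MemLp D 2 volume) (hw : MemLp w 2 volume) :
    Continuous fun r => ∫ t, D (t - r) (w t) := by
  have hmp : ∀ r : ℝ, MeasurePreserving (fun t => t - r) (volume : Measure ℝ) volume :=
    fun r => measurePreserving_sub_right volume r
  let translation : C(ℝ, C(ℝ, ℝ)) :=
    ContinuousMap.curry ⟨fun q : ℝ × ℝ => q.2 - q.1, by fun_prop⟩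
  let translate : ℝ → Lp (StrongDual ℝ V) 2 (volume : Measure ℝ) := fun r =>
    Lp.compMeasurePreserving (translation r) (hmp r) (hD.toLp D)
  have htranslate : Continuous translate :=
    Continuous.compMeasurePreservingLp continuous_const translation.continuous hmp (by simp)
  have htranslate_ae : ∀ r, translate r =ᵐ[volume] fun t => D (t - r) := fun r =>
    (Lp.coeFn_compMeasurePreserving (hD.toLp D) (hmp r)).trans
      ((hmp r).quasiMeasurePreserving.ae_eq_comp hD.coeFn_toLp)
  let pairing := ContinuousLinearMap.lpPairing (volume : Measure ℝ) 2 2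
    (ContinuousLinearMap.id ℝ (StrongDual ℝ V))
  have hpairing : ∀ r, pairing (translate r) (hw.toLp w) = ∫ t, D (t - r) (w t) := by
    intro r
    rw [ContinuousLinearMap.lpPairing_eq_integral]
    refine integral_congr_ae ?_
    filter_upwards [htranslate_ae r, hw.coeFn_toLp] with t hDt hwt
    rw [hDt, hwt, ContinuousLinearMap.id_apply]
  simp_rw [← hpairing]
  exact (pairing.continuous.comp htranslate).clm_apply continuous_const

lemma continuous_setIntegral_translate_pairing {D : ℝ → StrongDual ℝ V} {w : ℝ → V} {A : Set ℝ}
    (hA : MeasurableSet A) (hD : MemLp D 2 volume) (hw : MemLp w 2 (volume.restrict A)) :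
    Continuous fun r => ∫ t in A, D (t - r) (w t) := by
  convert continuous_integral_translate_pairing hD ((memLp_indicator_iff_restrict hA).2 hw)
    using 2 with r
  rw [← integral_indicator hA]
  refine integral_congr_ae (Eventually.of_forall fun t => ?_)
  by_cases ht : t ∈ A <;> simp [ht]

lemma integrable_translate_pairing {D : ℝ → StrongDual ℝ V} {w : ℝ → V} {ν : Measure ℝ}
    [SFinite ν] (hD : Integrable D volume) (hw : Integrable w ν) :
    Integrable (fun z : ℝ × ℝ => D (z.2 - z.1) (w z.2)) (volume.prod ν) := by
  refine (hw.convolution_integrand (ContinuousLinearMap.id ℝ (StrongDual ℝ V)).flip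
    hD.comp_neg).congr (Eventually.of_forall fun z => ?_)
  simp

lemma integral_sub_translate_le_integral_pairing {E : ℝ → ℝ} (hE : Continuous E)
    {D : ℝ → StrongDual ℝ V} {w : ℝ → V} {h s : ℝ} (hh : 0 ≤ h) (hs : 0 ≤ s)
    (hD : Integrable D volume) (hw : IntegrableOn w (Ioc 0 s))
    (hinc : ∀ᵐ t ∂volume.restrict (Ioc 0 s), E t - E (t - h) ≤ (∫ r in (t - h)..t, D r) (w t)) :
    ∫ t in (0 : ℝ)..s, (E t - E (t - h)) ≤
      ∫ r in (0 : ℝ)..h, ∫ t in Ioc 0 s, D (t - r) (w t) := by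
  have hint : Integrable (Function.uncurry fun r t => D (t - r) (w t))
      ((volume.restrict (Ioc 0 h)).prod (volume.restrict (Ioc 0 s))) :=
    (integrable_translate_pairing hD hw).mono_measure
      (Measure.prod_mono Measure.restrict_le_self le_rfl)
  rw [intervalIntegral.integral_of_le hs, intervalIntegral.integral_of_le hh,
    integral_integral_swap hint]
  refine integral_mono_ae (by fun_prop : Continuous fun t => E t - E (t - h)).integrableOn_Ioc
    hint.integral_prod_right ?_
  filter_upwards [hinc] with t ht
  have hcomm : ∫ r in (0 : ℝ)..h, D (t - r) (w t) = (∫ r in (t - h)..t, D r) (w t) := by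
    rw [← ContinuousLinearMap.intervalIntegral_apply
      (hD.comp_sub_left t).intervalIntegrable, intervalIntegral.integral_comp_sub_left D, sub_zero]
  rwa [← intervalIntegral.integral_of_le hh, hcomm]

lemma hasDerivAt_integral_sub_translate {E : ℝ → ℝ} (hE : Continuous E) (a b : ℝ) :
    HasDerivAt (fun h => ∫ t in a..b, (E t - E (t - h))) (E b - E a) 0 := by
  have hint : ∀ c d : ℝ, IntervalIntegrable E volume c d := hE.intervalIntegrable
  have hprim : ∀ c : ℝ, HasDerivAt (fun h : ℝ => ∫ r in (0 : ℝ)..(c - h), E r) (-E c) 0 := by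
    intro c
    refine ((hE.integral_hasStrictDerivAt 0 (c - 0)).hasDerivAt.comp (0 : ℝ)
      ((hasDerivAt_id (0 : ℝ)).const_sub c)).congr_deriv ?_
    simp
  have hsplit : (fun h => ∫ t in a..b, (E t - E (t - h))) = fun h =>
      (∫ t in a..b, E t) - ((∫ t in (0 : ℝ)..(b - h), E t) - ∫ t in (0 : ℝ)..(a - h), E t) := by
    funext h
    rw [intervalIntegral.integral_sub (hint _ _)
        ((by fun_prop : Continuous fun t => E (t - h)).intervalIntegrable _ _),
      intervalIntegral.integral_comp_sub_right E,
      intervalIntegral.integral_interval_sub_left (hint _ _) (hint _ _)]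
  rw [hsplit]
  exact (((hprim b).sub (hprim a)).const_sub _).congr_deriv (by ring)

theorem sub_le_integral_pairing {E : ℝ → ℝ} (hE : Continuous E) {D : ℝ → StrongDual ℝ V}
    {w : ℝ → V} (hD2 : MemLp D 2 volume) (hD : Integrable D volume) {s : ℝ} (hs : 0 ≤ s)
    (hw : MemLp w 2 (volume.restrict (Ioc 0 s)))
    (hinc : ∀ᵐ t ∂volume.restrict (Ioc 0 s), ∀ h, 0 < h → h < 1 →
      E t - E (t - h) ≤ (∫ r in (t - h)..t, D r) (w t)) :
    E s - E 0 ≤ ∫ t in Ioc 0 s, D t (w t) := by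
  let q : ℝ → ℝ := fun r => ∫ t in Ioc 0 s, D (t - r) (w t)
  have hq : Continuous q := continuous_setIntegral_translate_pairing measurableSet_Ioc hD2 hw
  have hderiv : HasDerivAt
      (fun h => (∫ r in (0 : ℝ)..h, q r) - ∫ t in (0 : ℝ)..s, (E t - E (t - h)))
      (q 0 - (E s - E 0)) 0 :=
    (hq.integral_hasStrictDerivAt 0 0).hasDerivAt.sub (hasDerivAt_integral_sub_translate hE 0 s)
  have hnonneg : 0 ≤ q 0 - (E s - E 0) := by
    refine hasDerivAt_nonneg_of_nonneg_right hderiv (by simp) one_pos fun h hh => ?_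
    rw [zero_add] at hh
    refine sub_nonneg.2 (integral_sub_translate_le_integral_pairing hE hh.1.le hs hD
      (hw.integrable one_le_two) ?_)
    filter_upwards [hinc] with t ht using ht h hh.1 hh.2
  simpa [q] using hnonneg

end Energy

section WeakDerivative

lemma contDiff_integral_right {E : Type*} [NormedAddCommGroup E] [NormedSpace ℝ E]
    [CompleteSpace E] {f : ℝ → E} (hf : ContDiff ℝ ∞ f) (a : ℝ) :
    ContDiff ℝ ∞ fun t => ∫ x in a..t, f x := by
  have hderiv : ∀ t, HasDerivAt (fun t => ∫ x in a..t, f x) (f t) t :=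
    fun t => (hf.continuous.integral_hasStrictDerivAt a t).hasDerivAt
  rw [contDiff_infty_iff_deriv, show deriv (fun t => ∫ x in a..t, f x) = f from
    funext fun t => (hderiv t).deriv]
  exact ⟨fun t => (hderiv t).differentiableAt, hf⟩

namespace IsTimeTest

variable {T : ℝ} {η : ℝ → ℝ}

lemma eq_zero (hη : IsTimeTest T η) {t : ℝ} (ht : t ∉ Ioo 0 T) : η t = 0 :=
  image_eq_zero_of_notMem_tsupport fun h => ht (hη.2.2 h)

lemma exists_tsupport_subset_Icc (hT : 0 < T) (hη : IsTimeTest T η) :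
    ∃ a b, 0 < a ∧ b < T ∧ tsupport η ⊆ Icc a b := by
  rcases (tsupport η).eq_empty_or_nonempty with hempty | hne
  · exact ⟨T, 0, hT, hT, by simp [hempty]⟩
  · obtain ⟨a, ha⟩ := hη.2.1.isCompact.exists_isLeast hne
    obtain ⟨b, hb⟩ := hη.2.1.isCompact.exists_isGreatest hne
    exact ⟨a, b, (hη.2.2 ha.1).1, (hη.2.2 hb.1).2, fun x hx => ⟨ha.2 hx, hb.2 hx⟩⟩

lemma exists_deriv_eq (hT : 0 < T) (hη : IsTimeTest T η) (hzero : ∫ t in (0 : ℝ)..T, η t = 0) :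
    ∃ ζ, IsTimeTest T ζ ∧ deriv ζ = η := by
  obtain ⟨a, b, ha, hb, hab⟩ := hη.exists_tsupport_subset_Icc hT
  have hη0 : ∀ x, x ∉ Icc a b → η x = 0 := fun x hx =>
    image_eq_zero_of_notMem_tsupport fun h => hx (hab h)
  have hint : ∀ c d, IntervalIntegrable η volume c d := hη.1.continuous.intervalIntegrable
  have hsupp : tsupport (fun t => ∫ x in (0 : ℝ)..t, η x) ⊆ Icc a b := by
    refine closure_minimal (fun t ht => ?_) isClosed_Icc
    by_contra htab
    refine ht ?_
    rw [mem_Icc, not_and_or, not_le, not_le] at htab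
    rcases htab with hta | hbt
    · refine intervalIntegral.integral_zero_ae
        (Eventually.of_forall fun x hx => hη0 x fun hxab => ?_)
      rcases mem_uIoc.1 hx with hx | hx <;> linarith [hxab.1, hx.2]
    · dsimp only
      rw [← intervalIntegral.integral_add_adjacent_intervals (hint 0 T) (hint T t), hzero, zero_add]
      refine intervalIntegral.integral_zero_ae
        (Eventually.of_forall fun x hx => hη0 x fun hxab => ?_)
      rcases mem_uIoc.1 hx with hx | hx <;> linarith [hxab.2, hx.1]
  exact ⟨fun t => ∫ x in (0 : ℝ)..t, η x, ⟨contDiff_integral_right hη.1 0,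
      HasCompactSupport.of_support_subset_isCompact isCompact_Icc
        ((subset_tsupport _).trans hsupp),
      hsupp.trans fun x hx => ⟨ha.trans_le hx.1, hx.2.trans_lt hb⟩⟩,
    funext fun t => (hη.1.continuous.integral_hasStrictDerivAt 0 t).hasDerivAt.deriv⟩

lemma exists_integral_eq_one (hT : 0 < T) : ∃ η, IsTimeTest T η ∧ ∫ t in Ioc 0 T, η t = 1 := by
  let bump : ContDiffBump (T / 2) := ⟨T / 8, T / 4, by linarith, by linarith⟩
  have hbump : IsTimeTest T (bump.normed volume) := by
    refine ⟨bump.contDiff_normed, bump.hasCompactSupport_normed, ?_⟩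
    rw [bump.tsupport_normed_eq, Real.closedBall_eq_Icc]
    exact Icc_subset_Ioo (by simp only [bump]; linarith) (by simp only [bump]; linarith)
  refine ⟨bump.normed volume, hbump, ?_⟩
  rw [setIntegral_eq_integral_of_forall_compl_eq_zero
    fun t ht => hbump.eq_zero fun h => ht (Ioo_subset_Ioc_self h), bump.integral_normed]

lemma sub_const_mul {χ : ℝ → ℝ} (hη : IsTimeTest T η) (hχ : IsTimeTest T χ) (c : ℝ) :
    IsTimeTest T fun t => η t - c * χ t :=
  ⟨hη.1.sub (contDiff_const.mul hχ.1), hη.2.1.sub hχ.2.1.mul_left,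
    (tsupport_sub _ _).trans (union_subset hη.2.2 (tsupport_mul_subset_right.trans hχ.2.2))⟩

end IsTimeTest

section Vector

variable {E : Type*} [NormedAddCommGroup E] [NormedSpace ℝ E]

lemma integrableOn_smul_Ioc {T : ℝ} {z : ℝ → ℝ} {f : ℝ → E} (hz : Continuous z)
    (hf : ContinuousOn f (Icc 0 T)) : IntegrableOn (fun t => z t • f t) (Ioc 0 T) :=
  (hz.continuousOn.smul hf).integrableOn_Icc.mono_set Ioc_subset_Icc_self

lemma exists_integral_smul_sub_eq_zero [CompleteSpace E] {T : ℝ} (hT : 0 < T) {f : ℝ → E}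
    (hf : ContinuousOn f (Icc 0 T))
    (hzero : ∀ η, IsTimeTest T η → ∫ t in Ioc 0 T, deriv η t • f t = 0) :
    ∃ c : E, ∀ η, IsTimeTest T η → ∫ t in Ioc 0 T, η t • (f t - c) = 0 := by
  obtain ⟨χ, hχ, hχ1⟩ := IsTimeTest.exists_integral_eq_one hT
  refine ⟨∫ t in Ioc 0 T, χ t • f t, fun η hη => ?_⟩
  set c := ∫ t in Ioc 0 T, χ t • f t
  set I := ∫ t in Ioc 0 T, η t
  -- `η - I χ` has zero mean, hence is the derivative of a test function
  obtain ⟨ζ, hζ, hζ'⟩ := (hη.sub_const_mul hχ I).exists_deriv_eq hT (by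
    rw [intervalIntegral.integral_of_le hT.le, integral_sub hη.1.continuous.integrableOn_Ioc
      (hχ.1.continuous.const_mul I).integrableOn_Ioc, integral_const_mul, hχ1, mul_one, sub_self])
  calc ∫ t in Ioc 0 T, η t • (f t - c)
      = (∫ t in Ioc 0 T, η t • f t) - I • c := by
        simp_rw [smul_sub]
        rw [integral_sub (integrableOn_smul_Ioc hη.1.continuous hf)
          (integrableOn_smul_Ioc hη.1.continuous continuousOn_const), integral_smul_const]
    _ = ∫ t in Ioc 0 T, (η t - I * χ t) • f t := by
        simp_rw [sub_smul, mul_smul]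
        rw [integral_sub, integral_smul]
        exacts [integrableOn_smul_Ioc hη.1.continuous hf,
          (integrableOn_smul_Ioc hχ.1.continuous hf).smul I]
    _ = 0 := by simpa only [hζ'] using hzero ζ hζ

lemma eq_of_forall_integral_deriv_smul_eq_zero [CompleteSpace E] {T : ℝ} (hT : 0 < T) {f : ℝ → E}
    (hf : ContinuousOn f (Icc 0 T))
    (hzero : ∀ η, IsTimeTest T η → ∫ t in Ioc 0 T, deriv η t • f t = 0) :
    ∀ t ∈ Icc 0 T, f t = f 0 := by
  obtain ⟨c, hc⟩ := exists_integral_smul_sub_eq_zero hT hf hzero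
  have hfc : ContinuousOn (fun t => f t - c) (Icc 0 T) := hf.sub continuousOn_const
  have hae : ∀ᵐ t ∂volume, t ∈ Ioo 0 T → f t - c = 0 := by
    refine isOpen_Ioo.ae_eq_zero_of_integral_contDiff_smul_eq_zero
      (hfc.integrableOn_Icc.mono_set Ioo_subset_Icc_self).locallyIntegrableOn
      fun η hη1 hη2 hη3 => ?_
    have hη : IsTimeTest T η := ⟨hη1, hη2, hη3⟩
    rw [← hc η hη]
    exact (setIntegral_eq_integral_of_forall_compl_eq_zero fun t ht => by
      rw [hη.eq_zero fun h => ht (Ioo_subset_Ioc_self h), zero_smul]).symm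
  have hconst : EqOn f (fun _ => c) (Icc 0 T) := by
    refine Measure.eqOn_Icc_of_ae_eq volume hT.ne ?_ hf continuousOn_const
    rw [← restrict_Ioo_eq_restrict_Icc, Filter.EventuallyEq, ae_restrict_iff' measurableSet_Ioo]
    filter_upwards [hae] with t ht htT using sub_eq_zero.1 (ht htT)
  intro t ht
  rw [hconst ht, hconst (left_mem_Icc.2 hT.le)]

end Vector

lemma IsTimeTest.integral_deriv_mul_primitive {T : ℝ} (hT : 0 ≤ T) {g η : ℝ → ℝ}
    (hg : IntervalIntegrable g volume 0 T) (hη : IsTimeTest T η) :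
    ∫ t in Ioc 0 T, deriv η t * ∫ x in (0 : ℝ)..t, g x = -∫ t in Ioc 0 T, η t * g t := by
  have hG := hg.absolutelyContinuousOnInterval_intervalIntegral left_mem_uIcc
  have hηac : AbsolutelyContinuousOnInterval η 0 T :=
    ContDiffOn.absolutelyContinuousOnInterval (hη.1.of_le (by simp)).contDiffOn
  have hparts := hηac.integral_mul_deriv_eq_deriv_mul hG
  rw [hη.eq_zero (by simp), hη.eq_zero (by simp), zero_mul, zero_mul, sub_zero, zero_sub,
    intervalIntegral.integral_of_le hT, intervalIntegral.integral_of_le hT] at hparts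
  rw [← neg_eq_iff_eq_neg, ← hparts]
  refine integral_congr_ae ?_
  rw [EventuallyEq, ae_restrict_iff' measurableSet_Ioc]
  filter_upwards [hg.ae_hasDerivAt_integral] with t ht htT
  have htT' : t ∈ uIcc 0 T := by rw [uIcc_of_le hT]; exact Ioc_subset_Icc_self htT
  rw [(ht htT' 0 left_mem_uIcc).deriv]

theorem eq_add_integral_of_weak_deriv {T : ℝ} (hT : 0 < T) {f g : ℝ → ℝ}
    (hf : ContinuousOn f (Icc 0 T)) (hg : IntegrableOn g (Ioc 0 T))
    (hderiv : ∀ η, IsTimeTest T η →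
      ∫ t in Ioc 0 T, deriv η t * f t = -∫ t in Ioc 0 T, η t * g t) :
    ∀ t ∈ Icc 0 T, f t = f 0 + ∫ x in (0 : ℝ)..t, g x := by
  have hgi : IntervalIntegrable g volume 0 T :=
    (intervalIntegrable_iff_integrableOn_Ioc_of_le hT.le).2 hg
  have hG : ContinuousOn (fun t => ∫ x in (0 : ℝ)..t, g x) (Icc 0 T) := by
    simpa only [uIcc_of_le hT.le] using
      (hgi.absolutelyContinuousOnInterval_intervalIntegral left_mem_uIcc).continuousOn
  intro t ht
  have hconst := eq_of_forall_integral_deriv_smul_eq_zero hT (hf.sub hG) (fun η hη => by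
    have hη' : Continuous (deriv η) := hη.1.continuous_deriv (by simp)
    simp_rw [Pi.sub_apply, smul_sub]
    rw [integral_sub (integrableOn_smul_Ioc hη' hf) (integrableOn_smul_Ioc hη' hG)]
    simp_rw [smul_eq_mul]
    rw [hderiv η hη, hη.integral_deriv_mul_primitive hT.le hgi, sub_self]) t ht
  simp only [Pi.sub_apply, intervalIntegral.integral_same, sub_zero] at hconst
  exact sub_eq_iff_eq_add.1 hconst

end WeakDerivative

section Nemytskii

variable {α : Type*} {_ : MeasurableSpace α} {μ : Measure α}
  {E : Type*} [NormedAddCommGroup E]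

/-- `N` is the superposition (Nemytskii) operator `f ↦ θ ∘ f` on `L²(μ)`; a predicate, because
bounded and Lipschitz functions `θ` yield this operator by different constructions. -/
def IsNemytskii (θ : ℝ → ℝ) (N : Lp ℝ 2 μ → Lp ℝ 2 μ) : Prop :=
  ∀ f : Lp ℝ 2 μ, N f =ᵐ[μ] fun x => θ (f x)

lemma IsNemytskii.neg {θ : ℝ → ℝ} {N : Lp ℝ 2 μ → Lp ℝ 2 μ} (hN : IsNemytskii θ N) :
    IsNemytskii (fun x => -θ x) fun f => -N f := by
  intro f
  filter_upwards [hN f, Lp.coeFn_neg (N f)] with x hx hneg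
  rw [hneg, Pi.neg_apply, hx]

lemma lp_two_integrable_norm_sq (f : Lp E 2 μ) : Integrable (fun x => ‖f x‖ ^ 2) μ :=
  (Lp.memLp f).integrable_norm_pow two_ne_zero

variable [InnerProductSpace ℝ E]

lemma lp_two_norm_sq_eq_integral (f : Lp E 2 μ) : ‖f‖ ^ 2 = ∫ x, ‖f x‖ ^ 2 ∂μ := by
  simp_rw [← real_inner_self_eq_norm_sq]
  exact L2.inner_def f f

lemma lp_two_tendsto_of_dominated {F : ℕ → Lp E 2 μ} {f G : Lp E 2 μ} {C : ℝ}
    (hdom : ∀ n, ∀ᵐ x ∂μ, ‖F n x - f x‖ ≤ C * ‖G x‖)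
    (hlim : ∀ᵐ x ∂μ, Tendsto (fun n => F n x) atTop (𝓝 (f x))) :
    Tendsto F atTop (𝓝 f) := by
  have hint : Tendsto (fun n => ∫ x, ‖F n x - f x‖ ^ 2 ∂μ) atTop (𝓝 (∫ _, (0 : ℝ) ∂μ)) := by
    refine tendsto_integral_of_dominated_convergence (fun x => C ^ 2 * ‖G x‖ ^ 2)
      (fun n => ((Lp.aestronglyMeasurable (F n)).sub (Lp.aestronglyMeasurable f)).norm.pow 2)
      ((lp_two_integrable_norm_sq G).const_mul _) (fun n => ?_) ?_
    · filter_upwards [hdom n] with x hx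
      rw [Real.norm_eq_abs, abs_of_nonneg (by positivity), ← mul_pow]
      exact pow_le_pow_left₀ (norm_nonneg _) hx 2
    · filter_upwards [hlim] with x hx
      simpa using ((hx.sub_const (f x)).norm).pow 2
  have hsq : ∀ n, ∫ x, ‖F n x - f x‖ ^ 2 ∂μ = ‖F n - f‖ ^ 2 := by
    intro n
    rw [lp_two_norm_sq_eq_integral]
    refine integral_congr_ae ?_
    filter_upwards [Lp.coeFn_sub (F n) f] with x hx
    rw [hx, Pi.sub_apply]
  simp_rw [hsq, integral_zero] at hint
  rw [tendsto_iff_norm_sub_tendsto_zero]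
  simpa using hint.sqrt

variable {θ : ℝ → ℝ} {C : ℝ}

lemma memLp_bdd_comp_smul (hθ : Continuous θ) (hC : ∀ x, |θ x| ≤ C) (f : Lp ℝ 2 μ)
    (G : Lp E 2 μ) : MemLp (fun x => θ (f x) • G x) 2 μ := by
  refine (Lp.memLp G).of_le_mul (c := C)
    ((hθ.comp_aestronglyMeasurable (Lp.aestronglyMeasurable f)).smul (Lp.aestronglyMeasurable G))
    (Eventually.of_forall fun x => ?_)
  rw [norm_smul]
  exact mul_le_mul_of_nonneg_right (hC _) (norm_nonneg _)

/-- The map `(f, G) ↦ θ(f) G` on `L²`, for a bounded continuous function `θ`. -/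
def bddCompSmul (hθ : Continuous θ) (hC : ∀ x, |θ x| ≤ C) (f : Lp ℝ 2 μ) (G : Lp E 2 μ) :
    Lp E 2 μ := (memLp_bdd_comp_smul hθ hC f G).toLp _

lemma coeFn_bddCompSmul (hθ : Continuous θ) (hC : ∀ x, |θ x| ≤ C) (f : Lp ℝ 2 μ) (G : Lp E 2 μ) :
    bddCompSmul hθ hC f G =ᵐ[μ] fun x => θ (f x) • G x := MemLp.coeFn_toLp _

lemma norm_bddCompSmul_le (hθ : Continuous θ) (hC : ∀ x, |θ x| ≤ C) (f : Lp ℝ 2 μ)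
    (G : Lp E 2 μ) : ‖bddCompSmul hθ hC f G‖ ≤ C * ‖G‖ := by
  refine Lp.norm_le_mul_norm_of_ae_le_mul ?_
  filter_upwards [coeFn_bddCompSmul hθ hC f G] with x hx
  rw [hx, norm_smul]
  exact mul_le_mul_of_nonneg_right (hC _) (norm_nonneg _)

lemma bddCompSmul_sub_right (hθ : Continuous θ) (hC : ∀ x, |θ x| ≤ C) (f : Lp ℝ 2 μ)
    (G H : Lp E 2 μ) :
    bddCompSmul hθ hC f (G - H) = bddCompSmul hθ hC f G - bddCompSmul hθ hC f H := by
  refine Lp.ext ?_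
  filter_upwards [coeFn_bddCompSmul hθ hC f G, coeFn_bddCompSmul hθ hC f H,
    coeFn_bddCompSmul hθ hC f (G - H), Lp.coeFn_sub G H,
    Lp.coeFn_sub (bddCompSmul hθ hC f G) (bddCompSmul hθ hC f H)] with x hG hH hGH hsub hcomp
  rw [hcomp, hGH, Pi.sub_apply, hG, hH, hsub, Pi.sub_apply, smul_sub]

lemma lipschitzWith_bddCompSmul_right (hθ : Continuous θ) (hC : ∀ x, |θ x| ≤ C) (f : Lp ℝ 2 μ) :
    LipschitzWith C.toNNReal fun G : Lp E 2 μ => bddCompSmul hθ hC f G := by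
  refine LipschitzWith.of_dist_le_mul fun G H => ?_
  rw [dist_eq_norm, dist_eq_norm, ← bddCompSmul_sub_right,
    Real.coe_toNNReal C ((abs_nonneg _).trans (hC 0))]
  exact norm_bddCompSmul_le hθ hC f (G - H)

lemma continuous_bddCompSmul_left (hθ : Continuous θ) (hC : ∀ x, |θ x| ≤ C) (G : Lp E 2 μ) :
    Continuous fun f : Lp ℝ 2 μ => bddCompSmul hθ hC f G := by
  rw [continuous_iff_seqContinuous]
  intro F f hF
  refine tendsto_of_subseq_tendsto fun ns hns => ?_
  obtain ⟨ms, -, hms⟩ := (tendstoInMeasure_of_tendsto_Lp (hF.comp hns)).exists_seq_tendsto_ae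
  refine ⟨ms, lp_two_tendsto_of_dominated (G := G) (C := C + C) (fun n => ?_) ?_⟩
  · filter_upwards [coeFn_bddCompSmul hθ hC (F (ns (ms n))) G, coeFn_bddCompSmul hθ hC f G]
      with x hFx hfx
    rw [Function.comp_apply, hFx, hfx, ← sub_smul, norm_smul]
    exact mul_le_mul_of_nonneg_right ((norm_sub_le _ _).trans (add_le_add (hC _) (hC _)))
      (norm_nonneg _)
  · filter_upwards [ae_all_iff.2 fun n => coeFn_bddCompSmul hθ hC (F (ns (ms n))) G,
      coeFn_bddCompSmul hθ hC f G, hms] with x hFx hfx hlim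
    simp only [Function.comp_apply, hFx, hfx]
    exact ((hθ.tendsto _).comp hlim).smul_const _

lemma continuous_bddCompSmul (hθ : Continuous θ) (hC : ∀ x, |θ x| ≤ C) :
    Continuous fun z : Lp ℝ 2 μ × Lp E 2 μ => bddCompSmul hθ hC z.1 z.2 :=
  continuous_prod_of_continuous_lipschitzWith' _ C.toNNReal
    (lipschitzWith_bddCompSmul_right hθ hC) (continuous_bddCompSmul_left hθ hC)

variable [IsFiniteMeasure μ]

/-- The map `f ↦ θ(f)` on `L²` of a finite measure, for a bounded continuous function `θ`. -/
def bddComp (hθ : Continuous θ) (hC : ∀ x, |θ x| ≤ C) (f : Lp ℝ 2 μ) : Lp ℝ 2 μ :=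
  bddCompSmul hθ hC f (Lp.const 2 μ (1 : ℝ))

lemma isNemytskii_bddComp (hθ : Continuous θ) (hC : ∀ x, |θ x| ≤ C) :
    IsNemytskii θ (bddComp hθ hC : Lp ℝ 2 μ → Lp ℝ 2 μ) := by
  intro f
  filter_upwards [coeFn_bddCompSmul hθ hC f (Lp.const 2 μ (1 : ℝ)),
    Lp.coeFn_const (μ := μ) 2 (1 : ℝ)] with x hcomp hone
  rw [bddComp, hcomp, hone, Function.const_apply, smul_eq_mul, mul_one]

lemma continuous_bddComp (hθ : Continuous θ) (hC : ∀ x, |θ x| ≤ C) :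
    Continuous (bddComp hθ hC : Lp ℝ 2 μ → Lp ℝ 2 μ) := continuous_bddCompSmul_left hθ hC _

end Nemytskii

section Sobolev

variable {d : ℕ} {Ω : Set (EPHSpace d)}

namespace IsTestFunction

variable {φ ψ : EPHSpace d → ℝ}

lemma eq_zero (hφ : IsTestFunction Ω φ) {x : EPHSpace d} (hx : x ∉ Ω) : φ x = 0 :=
  image_eq_zero_of_notMem_tsupport fun h => hx (hφ.2.2 h)

lemma zero : IsTestFunction Ω (fun _ => (0 : ℝ)) :=
  ⟨contDiff_const, HasCompactSupport.zero, by simp [tsupport]⟩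

lemma add (hφ : IsTestFunction Ω φ) (hψ : IsTestFunction Ω ψ) :
    IsTestFunction Ω (fun x => φ x + ψ x) :=
  ⟨hφ.1.add hψ.1, hφ.2.1.add hψ.2.1, (tsupport_add φ ψ).trans (union_subset hφ.2.2 hψ.2.2)⟩

lemma const_mul (hφ : IsTestFunction Ω φ) (a : ℝ) : IsTestFunction Ω (fun x => a * φ x) :=
  ⟨contDiff_const.mul hφ.1, hφ.2.1.mul_left, tsupport_mul_subset_right.trans hφ.2.2⟩

lemma comp (hφ : IsTestFunction Ω φ) {γ : ℝ → ℝ} (hγ : ContDiff ℝ ∞ γ) (hγ0 : γ 0 = 0) :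
    IsTestFunction Ω (fun x => γ (φ x)) :=
  ⟨hγ.comp hφ.1, hφ.2.1.comp_left hγ0, (tsupport_comp_subset hγ0 φ).trans hφ.2.2⟩

lemma continuous_gradient (hφ : IsTestFunction Ω φ) : Continuous (gradient φ) :=
  (InnerProductSpace.toDual ℝ (EPHSpace d)).symm.continuous.comp
    (hφ.1.continuous_fderiv (by simp))

lemma hasCompactSupport_gradient (hφ : IsTestFunction Ω φ) : HasCompactSupport (gradient φ) :=
  (hφ.2.1.fderiv (𝕜 := ℝ)).comp_left (g := (InnerProductSpace.toDual ℝ (EPHSpace d)).symm)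
    (map_zero _)

lemma memLp (hφ : IsTestFunction Ω φ) : MemLp φ 2 (volume.restrict Ω) :=
  (hφ.1.continuous.memLp_of_hasCompactSupport hφ.2.1).restrict Ω

lemma memLp_gradient (hφ : IsTestFunction Ω φ) : MemLp (gradient φ) 2 (volume.restrict Ω) :=
  (hφ.continuous_gradient.memLp_of_hasCompactSupport hφ.hasCompactSupport_gradient).restrict Ω

lemma hasGradientAt (hφ : IsTestFunction Ω φ) (x : EPHSpace d) :
    HasGradientAt φ (gradient φ x) x :=
  (hφ.1.differentiable (by simp) x).hasGradientAt

lemma gradient_add (hφ : IsTestFunction Ω φ) (hψ : IsTestFunction Ω ψ) (x : EPHSpace d) :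
    gradient (fun x => φ x + ψ x) x = gradient φ x + gradient ψ x := by
  refine HasGradientAt.gradient ?_
  rw [hasGradientAt_iff_hasFDerivAt, map_add]
  exact (hφ.hasGradientAt x).hasFDerivAt.add (hψ.hasGradientAt x).hasFDerivAt

lemma gradient_const_mul (hφ : IsTestFunction Ω φ) (a : ℝ) (x : EPHSpace d) :
    gradient (fun x => a * φ x) x = a • gradient φ x := by
  refine HasGradientAt.gradient ?_
  rw [hasGradientAt_iff_hasFDerivAt, map_smul]
  exact (hφ.hasGradientAt x).hasFDerivAt.const_mul a

lemma gradient_comp (hφ : IsTestFunction Ω φ) {γ : ℝ → ℝ} {γ' : ℝ} {x : EPHSpace d}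
    (hγ : HasDerivAt γ γ' (φ x)) : gradient (fun x => γ (φ x)) x = γ' • gradient φ x := by
  refine HasGradientAt.gradient ?_
  rw [hasGradientAt_iff_hasFDerivAt, map_smul]
  exact hγ.comp_hasFDerivAt x (hφ.hasGradientAt x).hasFDerivAt

end IsTestFunction

/-- The pair `(φ, ∇φ)` of a test function `φ`, as an element of `L²(Ω) × L²(Ω; ℝ^d)`. -/
def testPair (Ω : Set (EPHSpace d)) {φ : EPHSpace d → ℝ} (hφ : IsTestFunction Ω φ) : EPHPair Ω :=
  WithLp.toLp 2 (hφ.memLp.toLp φ, hφ.memLp_gradient.toLp (gradient φ))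

variable {φ ψ : EPHSpace d → ℝ}

lemma coeFn_testPair_fst (hφ : IsTestFunction Ω φ) :
    (testPair Ω hφ).fst =ᵐ[volume.restrict Ω] φ :=
  MemLp.coeFn_toLp hφ.memLp

lemma coeFn_testPair_snd (hφ : IsTestFunction Ω φ) :
    (testPair Ω hφ).snd =ᵐ[volume.restrict Ω] gradient φ :=
  MemLp.coeFn_toLp hφ.memLp_gradient

lemma testPair_mem (hφ : IsTestFunction Ω φ) : testPair Ω hφ ∈ H10Submodule Ω :=
  Submodule.le_topologicalClosure _ (Submodule.subset_span
    ⟨φ, hφ, coeFn_testPair_fst hφ, coeFn_testPair_snd hφ⟩)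

lemma eq_testPair (hφ : IsTestFunction Ω φ) {w : EPHPair Ω}
    (hfst : w.fst =ᵐ[volume.restrict Ω] φ) (hsnd : w.snd =ᵐ[volume.restrict Ω] gradient φ) :
    w = testPair Ω hφ :=
  WithLp.ofLp_injective 2 (Prod.ext (Lp.ext (hfst.trans (coeFn_testPair_fst hφ).symm))
    (Lp.ext (hsnd.trans (coeFn_testPair_snd hφ).symm)))

lemma testPair_zero : (0 : EPHPair Ω) = testPair Ω IsTestFunction.zero := by
  refine eq_testPair _ (Lp.coeFn_zero _ _ _)
    ((Lp.coeFn_zero _ _ _).trans (Eventually.of_forall fun x => ?_))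
  rw [gradient_fun_const, Pi.zero_apply]

lemma testPair_add (hφ : IsTestFunction Ω φ) (hψ : IsTestFunction Ω ψ) :
    testPair Ω hφ + testPair Ω hψ = testPair Ω (hφ.add hψ) := by
  refine eq_testPair _ ?_ ?_
  · filter_upwards [coeFn_testPair_fst hφ, coeFn_testPair_fst hψ,
      Lp.coeFn_add (testPair Ω hφ).fst (testPair Ω hψ).fst] with x hφx hψx hadd
    rw [WithLp.add_fst, hadd, Pi.add_apply, hφx, hψx]
  · filter_upwards [coeFn_testPair_snd hφ, coeFn_testPair_snd hψ,
      Lp.coeFn_add (testPair Ω hφ).snd (testPair Ω hψ).snd] with x hφx hψx hadd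
    rw [WithLp.add_snd, hadd, Pi.add_apply, hφx, hψx, hφ.gradient_add hψ]

lemma smul_testPair (hφ : IsTestFunction Ω φ) (a : ℝ) :
    a • testPair Ω hφ = testPair Ω (hφ.const_mul a) := by
  refine eq_testPair _ ?_ ?_
  · filter_upwards [coeFn_testPair_fst hφ, Lp.coeFn_smul a (testPair Ω hφ).fst] with x hφx hsmul
    rw [WithLp.smul_fst, hsmul, Pi.smul_apply, hφx, smul_eq_mul]
  · filter_upwards [coeFn_testPair_snd hφ, Lp.coeFn_smul a (testPair Ω hφ).snd] with x hφx hsmul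
    rw [WithLp.smul_snd, hsmul, Pi.smul_apply, hφx, hφ.gradient_const_mul]

lemma H10.mem_closure_testPair (w : H10 Ω) :
    (w : EPHPair Ω) ∈ closure {v | ∃ φ, ∃ hφ : IsTestFunction Ω φ, v = testPair Ω hφ} := by
  refine closure_mono (fun v hv => ?_) w.2
  induction hv using Submodule.span_induction with
  | mem v hv =>
    obtain ⟨φ, hφ, hfst, hsnd⟩ := hv
    exact ⟨φ, hφ, eq_testPair hφ hfst hsnd⟩
  | zero => exact ⟨_, _, testPair_zero⟩
  | add v w _ _ hv hw =>
    obtain ⟨φ, hφ, rfl⟩ := hv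
    obtain ⟨ψ, hψ, rfl⟩ := hw
    exact ⟨_, _, testPair_add hφ hψ⟩
  | smul a v _ hv =>
    obtain ⟨φ, hφ, rfl⟩ := hv
    exact ⟨_, _, smul_testPair hφ a⟩

lemma H10.mem_of_isClosed {A : Set (EPHPair Ω)} (hA : IsClosed A)
    (htest : ∀ φ (hφ : IsTestFunction Ω φ), testPair Ω hφ ∈ A) (w : H10 Ω) :
    (w : EPHPair Ω) ∈ A := by
  refine closure_minimal ?_ hA (H10.mem_closure_testPair w)
  rintro _ ⟨φ, hφ, rfl⟩
  exact htest φ hφ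

end Sobolev

/-- A `C¹` function that vanishes at the origin and whose derivative is bounded by `M`: the class
of functions that act on `H¹₀` by composition. -/
structure BoundedC1 (β : ℝ → ℝ) (M : ℝ) : Prop where
  contDiff : ContDiff ℝ 1 β
  zero : β 0 = 0
  bound : ∀ x, |deriv β x| ≤ M

namespace BoundedC1

variable {β : ℝ → ℝ} {M : ℝ}

lemma nonneg (h : BoundedC1 β M) : 0 ≤ M := (abs_nonneg _).trans (h.bound 0)

lemma differentiable (h : BoundedC1 β M) : Differentiable ℝ β := h.contDiff.differentiable (by simp)

lemma continuous_deriv (h : BoundedC1 β M) : Continuous (deriv β) :=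
  h.contDiff.continuous_deriv le_rfl

lemma lipschitz (h : BoundedC1 β M) : LipschitzWith M.toNNReal β := by
  refine lipschitzWith_of_nnnorm_deriv_le h.differentiable fun x => ?_
  rw [← NNReal.coe_le_coe, Real.coe_toNNReal _ h.nonneg]
  exact h.bound x

lemma abs_sub_le (h : BoundedC1 β M) (x y : ℝ) : |β x - β y| ≤ M * |x - y| := by
  have hdist := h.lipschitz.dist_le_mul x y
  rwa [Real.coe_toNNReal _ h.nonneg] at hdist

lemma abs_le (h : BoundedC1 β M) (x : ℝ) : |β x| ≤ M * |x| := by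
  simpa [h.zero] using h.abs_sub_le x 0

lemma id : BoundedC1 (fun x => x) 1 :=
  ⟨contDiff_id, rfl, fun x => by simp⟩

lemma comp {γ : ℝ → ℝ} {N : ℝ} (hγ : BoundedC1 γ N) (h : BoundedC1 β M) :
    BoundedC1 (fun x => γ (β x)) (N * M) where
  contDiff := hγ.contDiff.comp h.contDiff
  zero := by rw [h.zero, hγ.zero]
  bound x := by
    have hchain : deriv (fun x => γ (β x)) x = deriv γ (β x) * deriv β x :=
      deriv_comp x (hγ.differentiable _) (h.differentiable _)
    rw [hchain, abs_mul]
    exact mul_le_mul (hγ.bound _) (h.bound _) (abs_nonneg _) hγ.nonneg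

lemma of_integral {f : ℝ → ℝ} (hf : Continuous f) (hM : ∀ x, |f x| ≤ M) :
    BoundedC1 (fun t => ∫ x in (0 : ℝ)..t, f x) M := by
  have hd : ∀ t, HasDerivAt (fun t => ∫ x in (0 : ℝ)..t, f x) (f t) t :=
    fun t => (hf.integral_hasStrictDerivAt 0 t).hasDerivAt
  have hd' : deriv (fun t => ∫ x in (0 : ℝ)..t, f x) = f := funext fun t => (hd t).deriv
  exact ⟨contDiff_one_iff_deriv.2 ⟨fun t => (hd t).differentiableAt, by rwa [hd']⟩, by simp,
    by rwa [hd']⟩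

lemma exists_contDiff_sub (h : BoundedC1 β M) {δ : ℝ} (hδ : 0 < δ) :
    ∃ γ : ℝ → ℝ, ContDiff ℝ ∞ γ ∧ γ 0 = 0 ∧ BoundedC1 (fun t => β t - γ t) δ := by
  obtain ⟨f, hf, hfδ, -⟩ := h.continuous_deriv.exists_contDiff_approx (ε := fun _ => δ) ⊤
    continuous_const (fun _ => hδ)
  have hγ : ContDiff ℝ ∞ fun t => ∫ x in (0 : ℝ)..t, f x := contDiff_integral_right hf 0
  refine ⟨_, hγ, by simp, h.contDiff.sub (hγ.of_le (by simp)), by simp [h.zero], fun x => ?_⟩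
  have hderiv : deriv (fun t => β t - ∫ x in (0 : ℝ)..t, f x) x = deriv β x - f x :=
    ((h.differentiable x).hasDerivAt.sub
      (hf.continuous.integral_hasStrictDerivAt 0 x).hasDerivAt).deriv
  rw [hderiv, abs_sub_comm]
  exact (hfδ x).le

section CompL2

variable {α : Type*} {_ : MeasurableSpace α} {μ : Measure α}

/-- `f ↦ β(f)` on `L²`. -/
def compL2 (h : BoundedC1 β M) (f : Lp ℝ 2 μ) : Lp ℝ 2 μ := h.lipschitz.compLp h.zero f

lemma isNemytskii_compL2 (h : BoundedC1 β M) :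
    IsNemytskii β (h.compL2 : Lp ℝ 2 μ → Lp ℝ 2 μ) := fun f => h.lipschitz.coeFn_compLp h.zero f

lemma continuous_compL2 (h : BoundedC1 β M) : Continuous (h.compL2 : Lp ℝ 2 μ → Lp ℝ 2 μ) :=
  h.lipschitz.continuous_compLp h.zero

lemma compL2_comp {γ : ℝ → ℝ} {N : ℝ} (hγ : BoundedC1 γ N) (h : BoundedC1 β M) (f : Lp ℝ 2 μ) :
    (hγ.comp h).compL2 f = hγ.compL2 (h.compL2 f) := by
  refine Lp.ext ?_
  filter_upwards [(hγ.comp h).isNemytskii_compL2 f, hγ.isNemytskii_compL2 (h.compL2 f),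
    h.isNemytskii_compL2 f] with x hγβ hγ hβ
  rw [hγβ, hγ, hβ]

lemma norm_compL2_le (h : BoundedC1 β M) (f : Lp ℝ 2 μ) : ‖h.compL2 f‖ ≤ M * ‖f‖ := by
  refine Lp.norm_le_mul_norm_of_ae_le_mul ?_
  filter_upwards [h.isNemytskii_compL2 f] with x hx
  rw [hx]
  exact h.abs_le _

end CompL2

end BoundedC1

lemma withLp_norm_le_of_fst_snd_le {X Y : Type*} [SeminormedAddCommGroup X]
    [SeminormedAddCommGroup Y] {v w : WithLp 2 (X × Y)} {c : ℝ} (hc : 0 ≤ c)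
    (hfst : ‖v.fst‖ ≤ c * ‖w.fst‖) (hsnd : ‖v.snd‖ ≤ c * ‖w.snd‖) : ‖v‖ ≤ c * ‖w‖ := by
  refine le_of_sq_le_sq ?_ (by positivity)
  rw [mul_pow, WithLp.prod_norm_sq_eq_of_L2, WithLp.prod_norm_sq_eq_of_L2, mul_add, ← mul_pow,
    ← mul_pow]
  gcongr

section ChainRule

variable {d : ℕ} {Ω : Set (EPHSpace d)} {β : ℝ → ℝ} {M : ℝ}

namespace BoundedC1

/-- `(w, G) ↦ (β(w), β'(w) G)`, the action of `β` on pairs (function, gradient). -/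
def compPair (h : BoundedC1 β M) (w : EPHPair Ω) : EPHPair Ω :=
  WithLp.toLp 2 (h.compL2 w.fst, bddCompSmul h.continuous_deriv h.bound w.fst w.snd)

lemma continuous_compPair (h : BoundedC1 β M) : Continuous (h.compPair : EPHPair Ω → EPHPair Ω) :=
  (WithLp.prod_continuous_toLp 2 _ _).comp
    ((h.continuous_compL2.comp (WithLp.fstL 2 ℝ (EPHL2 Ω) (EPHL2Vec Ω)).continuous).prodMk
      ((continuous_bddCompSmul h.continuous_deriv h.bound).comp
        (WithLp.prod_continuous_ofLp 2 _ _)))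

lemma norm_compPair_le (h : BoundedC1 β M) (w : EPHPair Ω) : ‖h.compPair w‖ ≤ M * ‖w‖ :=
  withLp_norm_le_of_fst_snd_le h.nonneg (h.norm_compL2_le w.fst)
    (norm_bddCompSmul_le h.continuous_deriv h.bound w.fst w.snd)

lemma compPair_testPair_sub {φ : EPHSpace d → ℝ} {γ : ℝ → ℝ} {δ : ℝ} (h : BoundedC1 β M)
    (hφ : IsTestFunction Ω φ) (hγ : ContDiff ℝ ∞ γ) (hγ0 : γ 0 = 0)
    (hdiff : BoundedC1 (fun t => β t - γ t) δ) :
    h.compPair (testPair Ω hφ) - testPair Ω (hφ.comp hγ hγ0) = hdiff.compPair (testPair Ω hφ) := by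
  set w := testPair Ω hφ
  have hγd : Differentiable ℝ γ := hγ.differentiable (by simp)
  have hderiv : ∀ t, deriv (fun t => β t - γ t) t = deriv β t - deriv γ t := fun t =>
    deriv_sub (h.differentiable t) (hγd t)
  refine WithLp.ofLp_injective 2 (Prod.ext (Lp.ext ?_) (Lp.ext ?_))
  · filter_upwards [Lp.coeFn_sub (h.compPair w).fst (testPair Ω (hφ.comp hγ hγ0)).fst,
      h.isNemytskii_compL2 w.fst, hdiff.isNemytskii_compL2 w.fst,
      coeFn_testPair_fst (hφ.comp hγ hγ0), coeFn_testPair_fst hφ] with x hsub hβ hβγ hcomp hφx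
    calc (h.compPair w - testPair Ω (hφ.comp hγ hγ0)).fst x
        = h.compL2 w.fst x - (testPair Ω (hφ.comp hγ hγ0)).fst x := hsub
      _ = hdiff.compL2 w.fst x := by rw [hβ, hβγ, hcomp, hφx]
  · filter_upwards [Lp.coeFn_sub (h.compPair w).snd (testPair Ω (hφ.comp hγ hγ0)).snd,
      coeFn_bddCompSmul h.continuous_deriv h.bound w.fst w.snd,
      coeFn_bddCompSmul hdiff.continuous_deriv hdiff.bound w.fst w.snd,
      coeFn_testPair_snd (hφ.comp hγ hγ0), coeFn_testPair_fst hφ, coeFn_testPair_snd hφ]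
      with x hsub hβ hβγ hcomp hφx hgradx
    calc (h.compPair w - testPair Ω (hφ.comp hγ hγ0)).snd x
        = bddCompSmul h.continuous_deriv h.bound w.fst w.snd x
            - (testPair Ω (hφ.comp hγ hγ0)).snd x := hsub
      _ = bddCompSmul hdiff.continuous_deriv hdiff.bound w.fst w.snd x := by
        rw [hβ, hβγ, hcomp, hφx, hgradx, hderiv, sub_smul,
          hφ.gradient_comp (hγd (φ x)).hasDerivAt]

theorem compPair_mem (h : BoundedC1 β M) (w : H10 Ω) :
    h.compPair (w : EPHPair Ω) ∈ H10Submodule Ω := by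
  have hclosed : IsClosed (H10Submodule Ω : Set (EPHPair Ω)) :=
    Submodule.isClosed_topologicalClosure _
  refine H10.mem_of_isClosed (A := h.compPair ⁻¹' (H10Submodule Ω : Set (EPHPair Ω)))
    (hclosed.preimage h.continuous_compPair) (fun φ hφ => ?_) w
  rw [mem_preimage, ← hclosed.closure_eq, Metric.mem_closure_iff]
  intro ε hε
  obtain ⟨δ, hδ, hδε⟩ := exists_pos_mul_lt hε ‖testPair Ω hφ‖
  obtain ⟨γ, hγ, hγ0, hdiff⟩ := h.exists_contDiff_sub hδ
  refine ⟨testPair Ω (hφ.comp hγ hγ0), testPair_mem _, ?_⟩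
  rw [dist_eq_norm, h.compPair_testPair_sub hφ hγ hγ0 hdiff]
  exact (hdiff.norm_compPair_le _).trans_lt (by rwa [mul_comm])

/-- `w ↦ β(w)` on `H¹₀`. -/
def compH10 (h : BoundedC1 β M) (w : H10 Ω) : H10 Ω :=
  ⟨h.compPair (w : EPHPair Ω), h.compPair_mem w⟩

lemma continuous_compH10 (h : BoundedC1 β M) : Continuous (h.compH10 : H10 Ω → H10 Ω) :=
  (h.continuous_compPair.comp continuous_subtype_val).subtype_mk _

lemma fn_compH10 (h : BoundedC1 β M) (w : H10 Ω) :
    H10.fn (h.compH10 w) = h.compL2 (H10.fn w) := rfl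

lemma coeFn_fn_compH10 (h : BoundedC1 β M) (w : H10 Ω) :
    H10.fn (h.compH10 w) =ᵐ[volume.restrict Ω] fun x => β (H10.fn w x) :=
  h.isNemytskii_compL2 _

lemma coeFn_grad_compH10 (h : BoundedC1 β M) (w : H10 Ω) :
    H10.grad (h.compH10 w) =ᵐ[volume.restrict Ω]
      fun x => deriv β (H10.fn w x) • H10.grad w x :=
  coeFn_bddCompSmul h.continuous_deriv h.bound _ _

lemma norm_compH10_le (h : BoundedC1 β M) (w : H10 Ω) : ‖h.compH10 w‖ ≤ M * ‖w‖ :=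
  withLp_norm_le_of_fst_snd_le (v := (h.compH10 w : EPHPair Ω)) (w := (w : EPHPair Ω)) h.nonneg
    (h.norm_compL2_le (H10.fn w)) (norm_bddCompSmul_le h.continuous_deriv h.bound _ _)

end BoundedC1

end ChainRule

namespace H10

variable {d : ℕ} {Ω : Set (EPHSpace d)}

/-- `H10.fn` as a continuous linear map. -/
def fnL (Ω : Set (EPHSpace d)) : H10 Ω →L[ℝ] EPHL2 Ω :=
  (WithLp.fstL 2 ℝ (EPHL2 Ω) (EPHL2Vec Ω)).comp (H10Submodule Ω).subtypeL

lemma fnL_apply (w : H10 Ω) : fnL Ω w = fn w := rfl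

/-- `H10.grad` as a continuous linear map. -/
def gradL (Ω : Set (EPHSpace d)) : H10 Ω →L[ℝ] EPHL2Vec Ω :=
  (WithLp.sndL 2 ℝ (EPHL2 Ω) (EPHL2Vec Ω)).comp (H10Submodule Ω).subtypeL

lemma gradL_apply (w : H10 Ω) : gradL Ω w = grad w := rfl

lemma norm_sq (w : H10 Ω) : ‖w‖ ^ 2 = ‖fn w‖ ^ 2 + ‖grad w‖ ^ 2 :=
  WithLp.prod_norm_sq_eq_of_L2 (w : EPHPair Ω)

end H10

lemma IsTestFunction.integral_mul_inner_gradient {d : ℕ} {Ω : Set (EPHSpace d)}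
    {φ ψ : EPHSpace d → ℝ} (hφ : IsTestFunction Ω φ) (hψ : IsTestFunction Ω ψ) (e : EPHSpace d) :
    ∫ x in Ω, ψ x * inner ℝ (gradient φ x) e = -∫ x in Ω, φ x * inner ℝ (gradient ψ x) e := by
  have hfderiv : ∀ {χ : EPHSpace d → ℝ}, IsTestFunction Ω χ →
      (fun x => fderiv ℝ χ x e) = fun x => inner ℝ (gradient χ x) e := fun hχ => by
    ext x; rw [(hχ.hasGradientAt x).fderiv_apply]
  have hcont : ∀ {χ : EPHSpace d → ℝ}, IsTestFunction Ω χ →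
      Continuous fun x => fderiv ℝ χ x e := fun hχ =>
    (hχ.1.continuous_fderiv (by simp)).clm_apply continuous_const
  have hparts : ∫ x, ψ x * fderiv ℝ φ x e = -∫ x, fderiv ℝ ψ x e * φ x :=
    integral_mul_fderiv_eq_neg_fderiv_mul_of_integrable
      (((hcont hψ).mul hφ.1.continuous).integrable_of_hasCompactSupport hφ.2.1.mul_left)
      ((hψ.1.continuous.mul (hcont hφ)).integrable_of_hasCompactSupport hψ.2.1.mul_right)
      ((hψ.1.continuous.mul hφ.1.continuous).integrable_of_hasCompactSupport hφ.2.1.mul_left)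
      (fun x _ => hψ.1.differentiable (by simp) x) (fun x _ => hφ.1.differentiable (by simp) x)
  rw [setIntegral_eq_integral_of_forall_compl_eq_zero
      (fun x hx => by rw [hψ.eq_zero hx, zero_mul]),
    setIntegral_eq_integral_of_forall_compl_eq_zero
      (fun x hx => by rw [hφ.eq_zero hx, zero_mul])]
  simp only [fun x => mul_comm (φ x), ← congrFun (hfderiv hφ), ← congrFun (hfderiv hψ), hparts]

namespace H10

variable {d : ℕ} {Ω : Set (EPHSpace d)}

lemma integral_fn_mul_inner_gradient {φ : EPHSpace d → ℝ} (hφ : IsTestFunction Ω φ)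
    (e : EPHSpace d) (w : H10 Ω) :
    ∫ x in Ω, fn w x * inner ℝ (gradient φ x) e = -∫ x in Ω, φ x * inner ℝ (grad w x) e := by
  have hdiv : MemLp (fun x => inner ℝ (gradient φ x) e) 2 (volume.restrict Ω) :=
    hφ.memLp_gradient.inner_const e
  have hmul : MemLp (fun x => φ x • e) 2 (volume.restrict Ω) :=
    (ContinuousLinearMap.toSpanSingleton ℝ e).comp_memLp' hφ.memLp
  have hfst : ∀ f : EPHL2 Ω,
      inner ℝ hdiv.toLp f = ∫ x in Ω, f x * inner ℝ (gradient φ x) e := fun f => by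
    rw [L2.inner_def]
    refine integral_congr_ae ?_
    filter_upwards [hdiv.coeFn_toLp] with x hx
    rw [hx]; rfl
  have hsnd : ∀ G : EPHL2Vec Ω,
      inner ℝ hmul.toLp G = ∫ x in Ω, φ x * inner ℝ (G x) e := fun G => by
    rw [L2.inner_def]
    refine integral_congr_ae ?_
    filter_upwards [hmul.coeFn_toLp] with x hx
    rw [hx, real_inner_smul_left, real_inner_comm]
  have hclosed : IsClosed {w : EPHPair Ω | inner ℝ hdiv.toLp w.fst = -inner ℝ hmul.toLp w.snd} :=
    isClosed_eq (by fun_prop) (by fun_prop)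
  suffices h : inner ℝ hdiv.toLp (fn w) = -inner ℝ hmul.toLp (grad w) by
    rwa [hfst, hsnd] at h
  refine mem_of_isClosed hclosed (fun ψ hψ => ?_) w
  rw [mem_ofPred_eq, hfst, hsnd, integral_congr_ae, hφ.integral_mul_inner_gradient hψ e]
  · congr 1
    refine integral_congr_ae ?_
    filter_upwards [coeFn_testPair_snd hψ] with x hx
    rw [hx]
  · filter_upwards [coeFn_testPair_fst hψ] with x hx
    rw [hx]

lemma grad_eq_zero_of_fn_eq_zero (hΩ : IsOpen Ω) {w : H10 Ω} (hw : fn w = 0) : grad w = 0 := by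
  have hint : LocallyIntegrableOn (grad w) Ω :=
    locallyIntegrableOn_of_locallyIntegrable_restrict
      ((Lp.memLp (grad w)).locallyIntegrable one_le_two)
  have hzero : ∀ᵐ x, x ∈ Ω → grad w x = 0 := by
    refine hΩ.ae_eq_zero_of_integral_contDiff_smul_eq_zero hint fun φ hφ hφc hφΩ => ?_
    have hφ : IsTestFunction Ω φ := ⟨hφ, hφc, hφΩ⟩
    rw [← setIntegral_eq_integral_of_forall_compl_eq_zero (s := Ω)
      (fun x hx => by rw [hφ.eq_zero hx, zero_smul])]
    refine integral_eq_zero_of_forall_integral_inner_eq_zero ℝ _ ?_ fun e => ?_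
    · exact memLp_one_iff_integrable.1 ((Lp.memLp (grad w)).smul hφ.memLp)
    · have hparts := integral_fn_mul_inner_gradient hφ e w
      have hleft : ∫ x in Ω, fn w x * inner ℝ (gradient φ x) e = 0 := by
        refine integral_eq_zero_of_ae ?_
        filter_upwards [Lp.coeFn_zero ℝ 2 (volume.restrict Ω)] with x hx
        rw [hw, hx, Pi.zero_apply, zero_mul]
      rw [hleft, zero_eq_neg] at hparts
      simpa only [real_inner_smul_right, real_inner_comm] using hparts
  refine Lp.ext ?_
  filter_upwards [(ae_restrict_iff' hΩ.measurableSet).2 hzero, Lp.coeFn_zero (EPHSpace d) 2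
    (volume.restrict Ω)] with x hx h0
  rw [hx, h0, Pi.zero_apply]

theorem fn_injective (hΩ : IsOpen Ω) : Function.Injective (fn : H10 Ω → EPHL2 Ω) := by
  refine (injective_iff_map_eq_zero (fnL Ω)).2 fun w hw => ?_
  rw [fnL_apply] at hw
  rw [← norm_eq_zero, ← sq_eq_zero_iff, norm_sq, hw, grad_eq_zero_of_fn_eq_zero hΩ hw]
  simp

end H10

/-- A capillary pressure curve `pc` on `(0,1]` that crosses every scanning curve
`S + b(p) = constant` at most once. The monotonicity of `S + b(pc(S))` replaces the condition
`b'(pc) < -1 / pc'` on the slopes, and no differentiability is needed. -/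
structure ScanningCurve (b pc : ℝ → ℝ) : Prop where
  monotone : Monotone b
  continuousOn : ContinuousOn (fun S => b (pc S)) (Ioc 0 1)
  strictAntiOn : StrictAntiOn (fun S => b (pc S)) (Ioc 0 1)
  strictMonoOn : StrictMonoOn (fun S => S + b (pc S)) (Ioc 0 1)
  blowup : Tendsto pc (𝓝[>] 0) atTop

namespace ScanningCurve

variable {b pc : ℝ → ℝ} {S : ℝ}

theorem of_deriv (hb : ContDiff ℝ 1 b) (hb' : ∀ p, 0 ≤ deriv b p)
    (hpc : ContDiffOn ℝ 1 pc (Ioo 0 1)) (hpcc : ContinuousOn pc (Ioc 0 1))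
    (hneg : ∀ S ∈ Ioo (0 : ℝ) 1, deriv pc S < 0) (hblowup : Tendsto pc (𝓝[>] 0) atTop)
    (hslope : ∀ S ∈ Ioo (0 : ℝ) 1, 0 < deriv b (pc S) ∧ deriv b (pc S) < -1 / deriv pc S) :
    ScanningCurve b pc := by
  have hcont : ContinuousOn (fun S => b (pc S)) (Ioc 0 1) := hb.continuous.comp_continuousOn hpcc
  have hderiv : ∀ S ∈ Ioo (0 : ℝ) 1,
      HasDerivAt (fun S => b (pc S)) (deriv b (pc S) * deriv pc S) S := fun S hS =>
    (hb.differentiable one_ne_zero (pc S)).hasDerivAt.comp S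
      ((hpc.differentiableOn one_ne_zero).differentiableAt (isOpen_Ioo.mem_nhds hS)).hasDerivAt
  refine ⟨monotone_of_deriv_nonneg (hb.differentiable one_ne_zero) hb', hcont,
    strictAntiOn_of_deriv_neg (convex_Ioc 0 1) hcont fun S hS => ?_,
    strictMonoOn_of_deriv_pos (convex_Ioc 0 1) (continuousOn_id.add hcont) fun S hS => ?_, hblowup⟩
    <;> rw [interior_Ioc] at hS
  · rw [(hderiv S hS).deriv]
    exact mul_neg_of_pos_of_neg (hslope S hS).1 (hneg S hS)
  · have hone_add : deriv (fun S => S + b (pc S)) S = 1 + deriv b (pc S) * deriv pc S :=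
      ((hasDerivAt_id' S).add (hderiv S hS)).deriv
    have hlt := (hslope S hS).2
    rw [lt_div_iff_of_neg (hneg S hS)] at hlt
    exact hone_add ▸ by linarith

lemma le_one_add (h : ScanningCurve b pc) (x : ℝ) : b x ≤ 1 + b (pc 1) := by
  obtain ⟨S, hx, hS⟩ :=
    ((h.blowup.eventually_ge_atTop x).and (Ioo_mem_nhdsGT one_pos)).exists
  have hmono : S + b (pc S) < 1 + b (pc 1) :=
    h.strictMonoOn (Ioo_subset_Ioc_self hS) (right_mem_Ioc.2 one_pos) hS.2
  linarith [h.monotone hx, hS.1]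

lemma tendsto_bInfty (h : ScanningCurve b pc) : Tendsto b atTop (𝓝 (bInfty b)) :=
  tendsto_nhds_limUnder ⟨_, tendsto_atTop_ciSup h.monotone
    ⟨1 + b (pc 1), forall_mem_range.2 h.le_one_add⟩⟩

lemma le_bInfty (h : ScanningCurve b pc) (x : ℝ) : b x ≤ bInfty b :=
  h.monotone.ge_of_tendsto h.tendsto_bInfty x

lemma tendsto_comp (h : ScanningCurve b pc) :
    Tendsto (fun S => b (pc S)) (𝓝[>] 0) (𝓝 (bInfty b)) :=
  h.tendsto_bInfty.comp h.blowup

lemma tendsto_add_comp (h : ScanningCurve b pc) :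
    Tendsto (fun S => S + b (pc S)) (𝓝[>] 0) (𝓝 (bInfty b)) := by
  simpa using (tendsto_nhdsWithin_of_tendsto_nhds tendsto_id).add h.tendsto_comp

lemma half_mem_Ioc (hS : S ∈ Ioc (0 : ℝ) 1) : S / 2 ∈ Ioc (0 : ℝ) 1 ∧ S / 2 < S :=
  ⟨⟨half_pos hS.1, (half_le_self hS.1.le).trans hS.2⟩, half_lt_self hS.1⟩

lemma bInfty_lt (h : ScanningCurve b pc) (hS : S ∈ Ioc (0 : ℝ) 1) : bInfty b < S + b (pc S) := by
  obtain ⟨hhalf, hlt⟩ := half_mem_Ioc hS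
  refine (le_of_tendsto h.tendsto_add_comp ?_).trans_lt (h.strictMonoOn hhalf hS hlt)
  filter_upwards [Ioo_mem_nhdsGT hhalf.1] with x hx
  exact (h.strictMonoOn ⟨hx.1, hx.2.le.trans hhalf.2⟩ hhalf hx.2).le

lemma comp_lt_bInfty (h : ScanningCurve b pc) (hS : S ∈ Ioc (0 : ℝ) 1) : b (pc S) < bInfty b := by
  obtain ⟨hhalf, hlt⟩ := half_mem_Ioc hS
  exact (h.strictAntiOn hhalf hS hlt).trans_le (h.le_bInfty _)

lemma exists_add_comp_eq (h : ScanningCurve b pc) {v : ℝ} (hv : bInfty b < v)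
    (hv' : v < 1 + b (pc 1)) : ∃ S ∈ Ioo (0 : ℝ) 1, S + b (pc S) = v := by
  obtain ⟨R, hRv, hR⟩ :=
    ((h.tendsto_add_comp.eventually_lt_const hv).and (Ioo_mem_nhdsGT one_pos)).exists
  have hcont : ContinuousOn (fun S => S + b (pc S)) (Icc R 1) :=
    (continuousOn_id.add h.continuousOn).mono fun x hx => ⟨hR.1.trans_le hx.1, hx.2⟩
  obtain ⟨S, hS, hSv⟩ := intermediate_value_Ioo hR.2.le hcont ⟨hRv, hv'⟩
  exact ⟨S, Ioo_subset_Ioo_left hR.1.le hS, hSv⟩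

lemma exists_comp_eq (h : ScanningCurve b pc) {u : ℝ} (hu : b (pc 1) < u) (hu' : u < bInfty b) :
    ∃ S ∈ Ioo (0 : ℝ) 1, b (pc S) = u := by
  obtain ⟨R, hRu, hR⟩ :=
    ((h.tendsto_comp.eventually_const_lt hu').and (Ioo_mem_nhdsGT one_pos)).exists
  have hcont : ContinuousOn (fun S => b (pc S)) (Icc R 1) :=
    h.continuousOn.mono fun x hx => ⟨hR.1.trans_le hx.1, hx.2⟩
  obtain ⟨S, hS, hSu⟩ := intermediate_value_Ioo' hR.2.le hcont ⟨hu, hRu⟩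
  exact ⟨S, Ioo_subset_Ioo_left hR.1.le hS, hSu⟩

lemma rho_of_le {v : ℝ} (hv : v ≤ bInfty b) : rho b pc v = bInfty b := if_pos hv

lemma rho_of_ge (h : ScanningCurve b pc) {v : ℝ} (hv : 1 + b (pc 1) ≤ v) :
    rho b pc v = b (pc 1) := by
  rw [rho, if_neg ((h.bInfty_lt (right_mem_Ioc.2 one_pos)).trans_le hv).not_ge, if_pos hv]

lemma rho_add_comp (h : ScanningCurve b pc) (hS : S ∈ Ioo (0 : ℝ) 1) :
    rho b pc (S + b (pc S)) = b (pc S) := by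
  have hS' : S ∈ Ioc (0 : ℝ) 1 := Ioo_subset_Ioc_self hS
  have hinv : Function.invFunOn (fun S => S + b (pc S)) (Ioo 0 1) (S + b (pc S)) = S :=
    (h.strictMonoOn.mono Ioo_subset_Ioc_self).injOn.leftInvOn_invFunOn hS
  rw [rho, if_neg (h.bInfty_lt hS').not_ge,
    if_neg (h.strictMonoOn hS' (right_mem_Ioc.2 one_pos) hS.2).not_ge, hinv]

lemma trichotomy (h : ScanningCurve b pc) (v : ℝ) :
    v ≤ bInfty b ∨ 1 + b (pc 1) ≤ v ∨ ∃ S ∈ Ioo (0 : ℝ) 1, S + b (pc S) = v := by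
  rcases le_or_gt v (bInfty b) with hle | hgt
  · exact .inl hle
  rcases le_or_gt (1 + b (pc 1)) v with hge | hlt
  · exact .inr (.inl hge)
  · exact .inr (.inr (h.exists_add_comp_eq hgt hlt))

lemma rho_mem_Icc (h : ScanningCurve b pc) (v : ℝ) :
    rho b pc v ∈ Icc (b (pc 1)) (bInfty b) := by
  rcases h.trichotomy v with hv | hv | ⟨S, hS, rfl⟩
  · rw [rho_of_le hv]; exact ⟨h.le_bInfty _, le_rfl⟩
  · rw [h.rho_of_ge hv]; exact ⟨le_rfl, h.le_bInfty _⟩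
  · rw [h.rho_add_comp hS]
    exact ⟨(h.strictAntiOn (Ioo_subset_Ioc_self hS) (right_mem_Ioc.2 one_pos) hS.2).le,
      h.le_bInfty _⟩

lemma abs_rho_le (h : ScanningCurve b pc) (v : ℝ) :
    |rho b pc v| ≤ max |b (pc 1)| |bInfty b| :=
  abs_le_max_abs_abs (h.rho_mem_Icc v).1 (h.rho_mem_Icc v).2

lemma antitone_rho (h : ScanningCurve b pc) : Antitone (rho b pc) := by
  intro v w hvw
  rcases h.trichotomy v with hv | hv | ⟨S, hS, rfl⟩
  · rw [rho_of_le hv]; exact (h.rho_mem_Icc w).2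
  · rw [h.rho_of_ge hv, h.rho_of_ge (hv.trans hvw)]
  · have hS' := Ioo_subset_Ioc_self hS
    rcases h.trichotomy w with hw | hw | ⟨R, hR, rfl⟩
    · exact absurd (hvw.trans hw) (h.bInfty_lt hS').not_ge
    · rw [h.rho_of_ge hw]; exact (h.rho_mem_Icc _).1
    · have hR' := Ioo_subset_Ioc_self hR
      rw [h.rho_add_comp hS, h.rho_add_comp hR]
      exact h.strictAntiOn.antitoneOn hS' hR' ((h.strictMonoOn.le_iff_le hS' hR').1 hvw)

lemma continuous_rho (h : ScanningCurve b pc) : Continuous (rho b pc) := by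
  let f : ℝ → (Icc (b (pc 1)) (bInfty b))ᵒᵈ := fun v =>
    OrderDual.toDual ⟨rho b pc v, h.rho_mem_Icc v⟩
  have hmono : Monotone f := fun v w hvw => h.antitone_rho hvw
  have hsurj : Function.Surjective f := by
    rintro ⟨u, hu⟩
    suffices ∃ v, rho b pc v = u from this.imp fun v hv => Subtype.ext hv
    rcases hu.1.eq_or_lt with rfl | hlt
    · exact ⟨_, h.rho_of_ge le_rfl⟩
    rcases hu.2.eq_or_lt with rfl | hlt'
    · exact ⟨_, rho_of_le le_rfl⟩
    obtain ⟨S, hS, rfl⟩ := h.exists_comp_eq hlt hlt'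
    exact ⟨_, h.rho_add_comp hS⟩
  exact continuous_subtype_val.comp
    (continuous_ofDual.comp (hmono.continuous_of_surjective hsurj))

lemma rho_le_iff (h : ScanningCurve b pc) (hS : S ∈ Ioo (0 : ℝ) 1) {v : ℝ} :
    rho b pc v ≤ b (pc S) ↔ S + b (pc S) ≤ v := by
  have hS' := Ioo_subset_Ioc_self hS
  refine ⟨fun hle => ?_, fun hv => (h.antitone_rho hv).trans_eq (h.rho_add_comp hS)⟩
  rcases h.trichotomy v with hv | hv | ⟨R, hR, rfl⟩
  · rw [rho_of_le hv] at hle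
    exact absurd hle (h.comp_lt_bInfty hS').not_ge
  · exact ((h.strictMonoOn hS' (right_mem_Ioc.2 one_pos) hS.2).trans_le hv).le
  · have hR' := Ioo_subset_Ioc_self hR
    rw [h.rho_add_comp hR, h.strictAntiOn.le_iff_ge hR' hS'] at hle
    exact h.strictMonoOn.monotoneOn hS' hR' hle

end ScanningCurve

/-- The imbibition and drainage curves bounding the hysteresis loop. -/
structure HysteresisLoop (b pcI pcD : ℝ → ℝ) : Prop where
  imbibition : ScanningCurve b pcI
  drainage : ScanningCurve b pcD
  le : ∀ S ∈ Ioo (0 : ℝ) 1, pcI S ≤ pcD S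
  eq_one : pcI 1 = pcD 1

namespace HysteresisLoop

variable {b pcI pcD : ℝ → ℝ}

theorem of_capillaryCurves (hpc : CapillaryCurves pcI pcD) (hb : ScanningFunction pcI pcD b) :
    HysteresisLoop b pcI pcD where
  imbibition := .of_deriv hb.contDiff hb.deriv_nonneg hpc.contDiffI hpc.contI hpc.derivI_neg
    hpc.blowupI hb.boundI
  drainage := .of_deriv hb.contDiff hb.deriv_nonneg hpc.contDiffD hpc.contD hpc.derivD_neg
    hpc.blowupD hb.boundD
  le S hS := (hpc.lt S hS).le
  eq_one := hpc.eq_one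

lemma rho_le_rho (h : HysteresisLoop b pcI pcD) (v : ℝ) : rho b pcI v ≤ rho b pcD v := by
  rcases h.drainage.trichotomy v with hv | hv | ⟨S, hS, rfl⟩
  · exact (h.imbibition.rho_mem_Icc v).2.trans_eq (ScanningCurve.rho_of_le hv).symm
  · rw [h.drainage.rho_of_ge hv, h.imbibition.rho_of_ge (by rwa [h.eq_one]), h.eq_one]
  · have hle : b (pcI S) ≤ b (pcD S) := h.drainage.monotone (h.le S hS)
    rw [h.drainage.rho_add_comp hS]
    exact ((h.imbibition.rho_le_iff hS).2 (by gcongr)).trans hle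

lemma PhiTau_mul_nonpos (h : HysteresisLoop b pcI pcD) {ψ : ℝ → ℝ} (hψ : Monotone ψ) {τ : ℝ}
    (hτ : 0 < τ) (u v : ℝ) : PhiTau pcI pcD b τ u v * (ψ u - ψ (rho b pcD v)) ≤ 0 := by
  rw [PhiTau, mul_assoc]
  refine mul_nonpos_of_nonneg_of_nonpos (by positivity) ?_
  split_ifs with hgt hlt
  · exact mul_nonpos_of_nonpos_of_nonneg (sub_nonpos.2 hgt.le) (sub_nonneg.2 (hψ hgt.le))
  · exact mul_nonpos_of_nonneg_of_nonpos (sub_nonneg.2 hlt.le)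
      (sub_nonpos.2 (hψ (hlt.le.trans (h.rho_le_rho v))))
  · rw [zero_mul]

end HysteresisLoop

section Subgradient

variable {X : Type*} [NormedAddCommGroup X] [InnerProductSpace ℝ X]

/-- `N` is a selection of the subdifferential of `E`. -/
def IsSubgradient (E : X → ℝ) (N : X → X) : Prop := ∀ f g, E f - E g ≤ inner ℝ (N f) (f - g)

lemma IsSubgradient.continuous {E : X → ℝ} {N : X → X} (hN : IsSubgradient E N)
    (hNc : Continuous N) : Continuous E := by
  refine continuous_iff_continuousAt.2 fun g => ?_
  rw [ContinuousAt, ← tendsto_sub_nhds_zero_iff]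
  have hupper : Tendsto (fun f => inner ℝ (N f) (f - g)) (𝓝 g) (𝓝 0) := by
    simpa using (by fun_prop : Continuous fun f => inner ℝ (N f) (f - g)).tendsto g
  have hlower : Tendsto (fun f => -inner ℝ (N g) (g - f)) (𝓝 g) (𝓝 0) := by
    simpa using (by fun_prop : Continuous fun f => -inner ℝ (N g) (g - f)).tendsto g
  exact tendsto_of_tendsto_of_tendsto_of_le_of_le hlower hupper
    (fun f => by linarith [hN g f]) fun f => hN f g

end Subgradient

section ConvexFunctional

lemma integral_le_mul_sub_of_monotone {θ : ℝ → ℝ} (hθ : Monotone θ) (x y : ℝ) :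
    ∫ z in y..x, θ z ≤ θ x * (x - y) := by
  rcases le_total y x with hyx | hxy
  · calc ∫ z in y..x, θ z ≤ ∫ _ in y..x, θ x :=
          intervalIntegral.integral_mono_on hyx hθ.intervalIntegrable (by simp)
            fun z hz => hθ hz.2
      _ = θ x * (x - y) := by simp [mul_comm]
  · have hle : ∫ _ in x..y, θ x ≤ ∫ z in x..y, θ z :=
      intervalIntegral.integral_mono_on hxy (by simp) hθ.intervalIntegrable fun z hz => hθ hz.1
    rw [intervalIntegral.integral_const, smul_eq_mul] at hle
    rw [intervalIntegral.integral_symm]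
    linarith

variable {θ : ℝ → ℝ} {a : ℝ}

lemma integral_nonneg_of_monotone (hθ : Monotone θ) (ha : θ a = 0) (x : ℝ) :
    0 ≤ ∫ y in a..x, θ y := by
  have hle := integral_le_mul_sub_of_monotone hθ a x
  rw [ha, zero_mul, intervalIntegral.integral_symm] at hle
  linarith

lemma integral_eq_zero_iff_of_monotone (hθ : Monotone θ) (hc : Continuous θ) (ha : θ a = 0)
    (x : ℝ) : ∫ y in a..x, θ y = 0 ↔ θ x = 0 := by
  refine ⟨fun h => ?_, fun h => ?_⟩
  · have hmin : IsLocalMin (fun x => ∫ y in a..x, θ y) x := .of_forall fun z => by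
      simpa only [h] using integral_nonneg_of_monotone hθ ha z
    exact hmin.hasDerivAt_eq_zero (hc.integral_hasStrictDerivAt a x).hasDerivAt
  · have hle := integral_le_mul_sub_of_monotone hθ x a
    rw [h, zero_mul] at hle
    exact hle.antisymm (integral_nonneg_of_monotone hθ ha x)

lemma abs_integral_le_of_monotone (hθ : Monotone θ) (a x : ℝ) :
    |∫ y in a..x, θ y| ≤ |θ x * x| + |θ 0 * x| + |∫ y in a..0, θ y| := by
  have hi : ∀ a b, IntervalIntegrable θ volume a b := fun _ _ => hθ.intervalIntegrable
  have hsplit : ∫ y in a..x, θ y = (∫ y in a..0, θ y) + ∫ y in 0..x, θ y :=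
    (intervalIntegral.integral_add_adjacent_intervals (hi _ _) (hi _ _)).symm
  have hupper := integral_le_mul_sub_of_monotone hθ x 0
  have hlower := integral_le_mul_sub_of_monotone hθ 0 x
  rw [intervalIntegral.integral_symm] at hlower
  rw [sub_zero] at hupper
  rw [zero_sub, mul_neg, neg_le_neg_iff] at hlower
  rw [hsplit, add_comm]
  refine (abs_add_le _ _).trans (add_le_add_left ?_ _)
  have := le_abs_self (θ x * x)
  have := neg_abs_le (θ 0 * x)
  have := abs_nonneg (θ x * x)
  have := abs_nonneg (θ 0 * x)
  exact abs_le.2 ⟨by linarith, by linarith⟩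

variable {α : Type*} {_ : MeasurableSpace α} {μ : Measure α}

/-- The functional `f ↦ ∫ Θ(f)` on `L²`, where `Θ` is the primitive of `θ` that vanishes at `a`. -/
def primitiveFunctional (θ : ℝ → ℝ) (a : ℝ) (f : Lp ℝ 2 μ) : ℝ := ∫ x, (∫ y in a..f x, θ y) ∂μ

lemma primitiveFunctional_neg (θ : ℝ → ℝ) (a : ℝ) (f : Lp ℝ 2 μ) :
    primitiveFunctional (fun y => -θ y) a f = -primitiveFunctional θ a f := by
  simp [primitiveFunctional, integral_neg]

lemma primitiveFunctional_id (f : Lp ℝ 2 μ) :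
    primitiveFunctional (fun y => y) 0 f = ‖f‖ ^ 2 / 2 := by
  rw [primitiveFunctional, lp_two_norm_sq_eq_integral, ← integral_div]
  refine integral_congr_ae (Eventually.of_forall fun x => ?_)
  simp

lemma primitiveFunctional_nonneg (hθ : Monotone θ) (ha : θ a = 0) (f : Lp ℝ 2 μ) :
    0 ≤ primitiveFunctional θ a f :=
  integral_nonneg fun _ => integral_nonneg_of_monotone hθ ha _

section FiniteMeasure

variable [IsFiniteMeasure μ] {N : Lp ℝ 2 μ → Lp ℝ 2 μ}

lemma integrable_primitive (hθ : Monotone θ) (hc : Continuous θ) (hN : IsNemytskii θ N) (a : ℝ)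
    (f : Lp ℝ 2 μ) : Integrable (fun x => ∫ y in a..f x, θ y) μ := by
  have hf : MemLp f 2 μ := Lp.memLp f
  have hbound : Integrable (fun x => |N f x * f x| + |θ 0 * f x| + |∫ y in a..(0 : ℝ), θ y|) μ :=
    (((Lp.memLp (N f)).integrable_mul hf).abs.add
      ((hf.integrable one_le_two).const_mul (θ 0)).abs).add (integrable_const _)
  have hprim : Continuous fun t => ∫ y in a..t, θ y :=
    intervalIntegral.continuous_primitive (fun a b => hc.intervalIntegrable a b) a
  refine hbound.mono' (hprim.comp_aestronglyMeasurable (Lp.aestronglyMeasurable f)) ?_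
  filter_upwards [hN f] with x hx
  rw [hx]
  exact abs_integral_le_of_monotone hθ a (f x)

lemma primitiveFunctional_eq_zero_iff (hθ : Monotone θ) (hc : Continuous θ)
    (hN : IsNemytskii θ N) (ha : θ a = 0) (f : Lp ℝ 2 μ) :
    primitiveFunctional θ a f = 0 ↔ ∀ᵐ x ∂μ, θ (f x) = 0 := by
  rw [primitiveFunctional, integral_eq_zero_iff_of_nonneg
    (fun x => integral_nonneg_of_monotone hθ ha (f x)) (integrable_primitive hθ hc hN a f)]
  exact eventually_congr (Eventually.of_forall fun x =>
    integral_eq_zero_iff_of_monotone hθ hc ha (f x))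

lemma isSubgradient_primitiveFunctional (hθ : Monotone θ) (hc : Continuous θ)
    (hN : IsNemytskii θ N) (a : ℝ) : IsSubgradient (primitiveFunctional θ a) N := by
  intro f g
  have hint := integrable_primitive hθ hc hN a
  rw [primitiveFunctional, primitiveFunctional, ← integral_sub (hint f) (hint g), L2.inner_def]
  refine integral_mono_ae ((hint f).sub (hint g)) (L2.integrable_inner _ _) ?_
  filter_upwards [hN f, Lp.coeFn_sub f g] with x hNx hsub
  rw [hNx, hsub, Pi.sub_apply, intervalIntegral.integral_interval_sub_left
    (hc.intervalIntegrable _ _) (hc.intervalIntegrable _ _)]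
  exact (integral_le_mul_sub_of_monotone hθ _ _).trans_eq (mul_comm _ _)

end FiniteMeasure

end ConvexFunctional

lemma integrable_inner_of_memLp_two {α : Type*} {_ : MeasurableSpace α} {μ : Measure α}
    {X : Type*} [NormedAddCommGroup X] [InnerProductSpace ℝ X] {f g : α → X} (hf : MemLp f 2 μ)
    (hg : MemLp g 2 μ) : Integrable (fun t => inner ℝ (f t) (g t)) μ :=
  memLp_one_iff_integrable.1 ((innerSL ℝ).memLp_of_bilin 1 hf hg)

lemma integrable_apply_of_memLp_two {α : Type*} {_ : MeasurableSpace α} {μ : Measure α}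
    {V : Type*} [NormedAddCommGroup V] [NormedSpace ℝ V] {D : α → StrongDual ℝ V} {w : α → V}
    (hD : MemLp D 2 μ) (hw : MemLp w 2 μ) : Integrable (fun t => D t (w t)) μ :=
  memLp_one_iff_integrable.1 ((ContinuousLinearMap.id ℝ (StrongDual ℝ V)).memLp_of_bilin 1 hD hw)

section AbstractEnergy

variable {V X : Type*} [NormedAddCommGroup V] [NormedSpace ℝ V]
  [NormedAddCommGroup X] [InnerProductSpace ℝ X]

variable {T : ℝ}

lemma memLp_two_indicator_Ioc {F : Type*} [NormedAddCommGroup F] {D : ℝ → F}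
    (hD : MemLp D 2 (timeMeasure T)) :
    MemLp (indicator (Ioc 0 T) D) 2 volume ∧ Integrable (indicator (Ioc 0 T) D) :=
  ⟨(memLp_indicator_iff_restrict measurableSet_Ioc).2 hD,
    (integrable_indicator_iff measurableSet_Ioc).2 (hD.integrable one_le_two)⟩

lemma intervalIntegral_indicator_Ioc {F : Type*} [NormedAddCommGroup F] [NormedSpace ℝ F]
    (D : ℝ → F) {t : ℝ} (ht : t ≤ T) :
    ∫ r in (0 : ℝ)..t, indicator (Ioc 0 T) D r = ∫ r in (0 : ℝ)..max 0 t, D r := by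
  rcases le_total t 0 with h0 | h0
  · rw [max_eq_left h0, intervalIntegral.integral_same, intervalIntegral.integral_symm,
      intervalIntegral.integral_of_le h0, setIntegral_eq_zero_of_forall_eq_zero, neg_zero]
    exact fun r hr => indicator_of_notMem (fun h => h.1.not_ge hr.2) _
  · rw [max_eq_right h0, intervalIntegral.integral_of_le h0, intervalIntegral.integral_of_le h0]
    exact setIntegral_congr_fun measurableSet_Ioc fun r hr =>
      indicator_of_mem (Ioc_subset_Ioc_right ht hr) _

/-- `D` is the derivative of `c` on `[0,T]` as a function with values in `V*`, where `X` is mapped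
to `V*` by the adjoint of `j`. -/
def HasDualDeriv (T : ℝ) (j : V →L[ℝ] X) (c : ℝ → X) (D : ℝ → StrongDual ℝ V) : Prop :=
  ∀ t ∈ Icc 0 T, ∀ φ, inner ℝ (c t) (j φ) = inner ℝ (c 0) (j φ) + ∫ s in (0 : ℝ)..t, D s φ

variable {j : V →L[ℝ] X} {c : ℝ → X} {D : ℝ → StrongDual ℝ V}

lemma HasDualDeriv.inner_max (hcD : HasDualDeriv T j c D) (hT : 0 ≤ T)
    (hD : IntegrableOn D (Ioc 0 T)) {t : ℝ} (ht : t ≤ T) (φ : V) :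
    inner ℝ (c (max 0 t)) (j φ) =
      inner ℝ (c 0) (j φ) + (∫ r in (0 : ℝ)..t, indicator (Ioc 0 T) D r) φ := by
  have hmem : max 0 t ∈ Icc 0 T := ⟨le_max_left 0 t, max_le hT ht⟩
  have hDmem : IntervalIntegrable D volume 0 (max 0 t) :=
    (intervalIntegrable_iff_integrableOn_Ioc_of_le hmem.1).2
      (hD.mono_set (Ioc_subset_Ioc_right hmem.2))
  rw [hcD _ hmem, intervalIntegral_indicator_Ioc D ht,
    ContinuousLinearMap.intervalIntegral_apply hDmem]

lemma HasDualDeriv.sub_le_of_isSubgradient (hcD : HasDualDeriv T j c D) (hT : 0 ≤ T)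
    (hD : IntegrableOn D (Ioc 0 T)) (hDi : Integrable (indicator (Ioc 0 T) D)) {E : X → ℝ}
    {N : X → X} (hN : IsSubgradient E N) {s t : ℝ} (hs : s ≤ T) (ht : t ≤ T) {φ : V}
    (hφ : j φ = N (c (max 0 t))) :
    E (c (max 0 t)) - E (c (max 0 s)) ≤ (∫ r in s..t, indicator (Ioc 0 T) D r) φ := by
  refine (hN _ _).trans_eq ?_
  rw [← hφ, real_inner_comm, inner_sub_left, hcD.inner_max hT hD hs, hcD.inner_max hT hD ht,
    add_sub_add_left_eq_sub, ← sub_apply, intervalIntegral.integral_interval_sub_left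
      hDi.intervalIntegrable hDi.intervalIntegrable]

theorem HasDualDeriv.convex_sub_le_integral (hcD : HasDualDeriv T j c D) (hT : 0 ≤ T)
    (hc : ContinuousOn c (Icc 0 T)) (hD : MemLp D 2 (timeMeasure T)) {E : X → ℝ}
    (hE : Continuous E) {N : X → X} (hN : IsSubgradient E N) {w : ℝ → V}
    (hw : MemLp w 2 (timeMeasure T)) (hwN : ∀ᵐ t ∂timeMeasure T, j (w t) = N (c t)) {s : ℝ}
    (hs : s ∈ Ioc 0 T) : E (c s) - E (c 0) ≤ ∫ t in Ioc 0 s, D t (w t) := by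
  obtain ⟨hDm, hDi⟩ := memLp_two_indicator_Ioc hD
  set e : ℝ → X := IccExtend hT ((Icc 0 T).domRestrict c) with he
  have hec : Continuous e := (continuousOn_iff_continuous_domRestrict.1 hc).Icc_extend'
  have he_max : ∀ t ≤ T, e t = c (max 0 t) := fun t ht => by
    simp only [he, IccExtend_apply, domRestrict_apply, min_eq_right ht]
  have hle : volume.restrict (Ioc 0 s) ≤ timeMeasure T :=
    Measure.restrict_mono (Ioc_subset_Ioc_right hs.2) le_rfl
  have henergy : E (e s) - E (e 0) ≤ ∫ t in Ioc 0 s, indicator (Ioc 0 T) D t (w t) := by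
    refine sub_le_integral_pairing (E := E ∘ e) (hE.comp hec) hDm hDi hs.1.le
      (hw.mono_measure hle) ?_
    filter_upwards [ae_mono hle hwN, ae_restrict_mem measurableSet_Ioc] with t hNt ht h h0 _
    have htT : t ≤ T := ht.2.trans hs.2
    have hshift : t - h ≤ T := by linarith
    rw [Function.comp_apply, Function.comp_apply, he_max t htT, he_max (t - h) hshift]
    exact hcD.sub_le_of_isSubgradient hT (hD.integrable one_le_two) hDi hN hshift htT
      (by rw [hNt, max_eq_right ht.1.le])
  rw [he_max s hs.2, he_max 0 hT, max_eq_right hs.1.le, max_self] at henergy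
  refine henergy.trans_eq (setIntegral_congr_fun measurableSet_Ioc fun t ht => ?_)
  simp only [indicator_of_mem (Ioc_subset_Ioc_right hs.2 ht)]

/-- The map `X → V*` adjoint to `j : V → X`. -/
def dualMap (j : V →L[ℝ] X) : X →L[ℝ] StrongDual ℝ V :=
  (ContinuousLinearMap.compL ℝ V X ℝ).flip j ∘L innerSL ℝ

lemma dualMap_apply (j : V →L[ℝ] X) (x : X) (φ : V) : dualMap j x φ = inner ℝ x (j φ) := rfl

lemma memLp_dualMap {α : Type*} {_ : MeasurableSpace α} {μ : Measure α} (j : V →L[ℝ] X)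
    {d : α → X} (hd : MemLp d 2 μ) : MemLp (fun t => dualMap j (d t)) 2 μ :=
  (dualMap j).comp_memLp' hd

lemma HasDualDeriv.of_weak_sub (hT : 0 < T) (hc : ContinuousOn c (Icc 0 T))
    (hD : Integrable D (timeMeasure T)) (x₀ : X)
    (hweak : ∀ η, IsTimeTest T η → ∀ φ,
      ∫ t in Ioc 0 T, deriv η t * inner ℝ (c t - x₀) (j φ) = -∫ t in Ioc 0 T, η t * D t φ) :
    HasDualDeriv T j c D := by
  intro t ht φ
  have hprim := eq_add_integral_of_weak_deriv hT (f := fun t => inner ℝ (c t - x₀) (j φ))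
    ((hc.sub continuousOn_const).inner continuousOn_const) (hD.apply_continuousLinearMap φ)
    (fun η hη => hweak η hη φ) t ht
  simp only [inner_sub_left] at hprim
  linarith

lemma IsTimeTest.integrable_smul {η : ℝ → ℝ} {F : Type*} [NormedAddCommGroup F] [NormedSpace ℝ F]
    {d : ℝ → F} (hη : IsTimeTest T η) (hd : Integrable d (timeMeasure T)) :
    Integrable (fun t => η t • d t) (timeMeasure T) := by
  obtain ⟨C, hC⟩ := hη.1.continuous.bounded_above_of_compact_support hη.2.1
  exact hd.bdd_smul C hη.1.continuous.aestronglyMeasurable (Eventually.of_forall hC)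

lemma IsTimeTest.deriv {η : ℝ → ℝ} (hη : IsTimeTest T η) : IsTimeTest T (deriv η) :=
  ⟨(contDiff_infty_iff_deriv.1 hη.1).2, hη.2.1.deriv, tsupport_deriv_subset.trans hη.2.2⟩

lemma HasDualDeriv.of_weak [CompleteSpace X] (hT : 0 < T) (hc : ContinuousOn c (Icc 0 T))
    {d : ℝ → X} (hd : Integrable d (timeMeasure T))
    (hweak : ∀ η, IsTimeTest T η →
      ∫ t in Ioc 0 T, deriv η t • c t = -∫ t in Ioc 0 T, η t • d t) :
    HasDualDeriv T j c fun t => dualMap j (d t) := by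
  refine .of_weak_sub hT hc ((dualMap j).integrable_comp hd) 0 fun η hη φ => ?_
  have hci : Integrable c (timeMeasure T) := hc.integrableOn_Icc.mono_set Ioc_subset_Icc_self
  have hpair := congrArg (inner ℝ (j φ)) (hweak η hη)
  rw [inner_neg_right, ← integral_inner ((IsTimeTest.deriv hη).integrable_smul hci),
    ← integral_inner (hη.integrable_smul hd)] at hpair
  simpa only [real_inner_smul_right, real_inner_comm (j φ), sub_zero, dualMap_apply] using hpair

lemma HasDualDeriv.sub {c' : ℝ → X} {D' : ℝ → StrongDual ℝ V} (hc : HasDualDeriv T j c D)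
    (hc' : HasDualDeriv T j c' D') (hD : Integrable D (timeMeasure T))
    (hD' : Integrable D' (timeMeasure T)) :
    HasDualDeriv T j (c - c') fun t => D t - D' t := by
  intro t ht φ
  have hint : ∀ {D : ℝ → StrongDual ℝ V}, Integrable D (timeMeasure T) →
      IntervalIntegrable (fun s => D s φ) volume 0 t := fun hD =>
    (intervalIntegrable_iff_integrableOn_Ioc_of_le ht.1).2
      (IntegrableOn.mono_set (hD.apply_continuousLinearMap φ) (Ioc_subset_Ioc_right ht.2))
  simp only [Pi.sub_apply, inner_sub_left, sub_apply, hc t ht φ, hc' t ht φ,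
    intervalIntegral.integral_sub (hint hD) (hint hD')]
  ring

theorem HasDualDeriv.convex_sub_le_integral_sub_integral [CompleteSpace X] {c' : ℝ → X} {d : ℝ → X}
    (hcD : HasDualDeriv T j c D) (hT : 0 < T) (hc : ContinuousOn c (Icc 0 T))
    (hc' : ContinuousOn c' (Icc 0 T)) (hD : MemLp D 2 (timeMeasure T))
    (hd : MemLp d 2 (timeMeasure T))
    (hweak : ∀ η, IsTimeTest T η →
      ∫ t in Ioc 0 T, deriv η t • c' t = -∫ t in Ioc 0 T, η t • d t)
    {E : X → ℝ} (hE : Continuous E) {N : X → X} (hN : IsSubgradient E N) {w : ℝ → V}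
    (hw : MemLp w 2 (timeMeasure T)) (hwN : ∀ᵐ t ∂timeMeasure T, j (w t) = N ((c' - c) t)) {s : ℝ}
    (hs : s ∈ Ioc 0 T) :
    E ((c' - c) s) - E ((c' - c) 0)
      ≤ (∫ t in Ioc 0 s, inner ℝ (d t) (j (w t))) - ∫ t in Ioc 0 s, D t (w t) := by
  have hd' := memLp_dualMap j hd
  have hjw : MemLp (fun t => j (w t)) 2 (timeMeasure T) := j.comp_memLp' hw
  have hle : volume.restrict (Ioc 0 s) ≤ timeMeasure T :=
    Measure.restrict_mono (Ioc_subset_Ioc_right hs.2) le_rfl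
  rw [← integral_sub ((integrable_inner_of_memLp_two hd hjw).mono_measure hle)
    ((integrable_apply_of_memLp_two hD hw).mono_measure hle)]
  exact ((HasDualDeriv.of_weak hT hc' (hd.integrable one_le_two) hweak).sub hcD
    (hd'.integrable one_le_two) (hD.integrable one_le_two)).convex_sub_le_integral hT.le
    (hc'.sub hc) (hd'.sub hD) hE hN hw hwN hs

end AbstractEnergy

section Testing

variable {T : ℝ}

lemma setIntegral_toLp_indicator {F : Type} [NormedAddCommGroup F] {w : ℝ → F} {s : ℝ}
    (hs : s ≤ T) (hw : MemLp (indicator (Ioc 0 s) w) 2 (timeMeasure T)) {f : ℝ → F → ℝ}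
    (hf : ∀ t, f t 0 = 0) :
    ∫ t in Ioc 0 T, f t (hw.toLp _ t) = ∫ t in Ioc 0 s, f t (w t) := by
  have hae : (fun t => f t (hw.toLp _ t)) =ᵐ[timeMeasure T]
      indicator (Ioc 0 s) fun t => f t (w t) := by
    filter_upwards [hw.coeFn_toLp] with t ht
    rw [ht]
    by_cases hts : t ∈ Ioc 0 s
    · rw [indicator_of_mem hts, indicator_of_mem hts]
    · rw [indicator_of_notMem hts, indicator_of_notMem hts, hf]
  rw [integral_congr_ae hae, setIntegral_indicator measurableSet_Ioc,
    inter_eq_self_of_subset_right (Ioc_subset_Ioc_right hs)]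

lemma setIntegral_eq_of_forall_lp_two {F : Type} [NormedAddCommGroup F] {f h : ℝ → F → ℝ}
    (hf : ∀ t, f t 0 = 0) (hh : ∀ t, h t 0 = 0)
    (heq : ∀ φ : L2Time T F, ∫ t in Ioc 0 T, f t (φ t) = ∫ t in Ioc 0 T, h t (φ t))
    {w : ℝ → F} (hw : MemLp w 2 (timeMeasure T)) {s : ℝ} (hs : s ≤ T) :
    ∫ t in Ioc 0 s, f t (w t) = ∫ t in Ioc 0 s, h t (w t) := by
  have hind : MemLp (indicator (Ioc 0 s) w) 2 (timeMeasure T) := hw.indicator measurableSet_Ioc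
  rw [← setIntegral_toLp_indicator hs hind hf, ← setIntegral_toLp_indicator hs hind hh, heq]

end Testing

namespace Permeability

variable {k : ℝ → ℝ}

lemma zero_lt_one (hk : Permeability k) : k 0 < k 1 :=
  (hk.between (1 / 2) (by norm_num)).1.trans (hk.between (1 / 2) (by norm_num)).2

lemma mem_Icc (hk : Permeability k) (S : ℝ) : k S ∈ Icc (k 0) (k 1) := by
  rcases le_or_gt S 0 with h0 | h0
  · rw [hk.left S h0]
    exact left_mem_Icc.2 hk.zero_lt_one.le
  rcases le_or_gt 1 S with h1 | h1
  · rw [hk.right S h1]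
    exact right_mem_Icc.2 hk.zero_lt_one.le
  · exact Ioo_subset_Icc_self (hk.between S ⟨h0, h1⟩)

lemma nonneg_apply (hk : Permeability k) (S : ℝ) : 0 ≤ k S := hk.nonneg.trans (hk.mem_Icc S).1

lemma abs_le (hk : Permeability k) (S : ℝ) : |k S| ≤ k 1 := by
  rw [abs_of_nonneg (hk.nonneg_apply S)]
  exact (hk.mem_Icc S).2

lemma exists_pos_le (hk : Permeability k) {s : ℝ} (hs : s ∈ Ioo (0 : ℝ) 1) :
    ∃ κ > 0, ∀ S ∈ Icc s 1, κ ≤ k S := by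
  obtain ⟨x, hx, hmin⟩ := isCompact_Icc.exists_isMinOn (nonempty_Icc.2 hs.2.le)
    hk.contDiff.continuous.continuousOn
  refine ⟨k x, ?_, fun S hS => hmin hS⟩
  rcases hx.2.eq_or_lt with rfl | hx1
  · exact hk.nonneg.trans_lt hk.zero_lt_one
  · exact hk.nonneg.trans_lt (hk.between x ⟨hs.1.trans_le hx.1, hx1⟩).1

end Permeability

section Flux

variable {d : ℕ} {Ω : Set (EPHSpace d)} [IsFiniteMeasure (volume.restrict Ω)] {k : ℝ → ℝ}
  {g : EPHSpace d}

/-- The flux `k(S)(∇p - g)` of the saturation `S` and the pressure gradient `G = ∇p`. -/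
def flux (hk : Permeability k) (g : EPHSpace d) (S : EPHL2 Ω) (G : EPHL2Vec Ω) : EPHL2Vec Ω :=
  bddCompSmul hk.contDiff.continuous hk.abs_le S (G - Lp.const 2 _ g)

lemma coeFn_flux (hk : Permeability k) (S : EPHL2 Ω) (G : EPHL2Vec Ω) :
    flux hk g S G =ᵐ[volume.restrict Ω] fun x => k (S x) • (G x - g) := by
  filter_upwards [coeFn_bddCompSmul hk.contDiff.continuous hk.abs_le S (G - Lp.const 2 _ g),
    Lp.coeFn_sub G (Lp.const 2 _ g), Lp.coeFn_const (μ := volume.restrict Ω) 2 g]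
    with x hflux hsub hconst
  rw [flux, hflux, hsub, Pi.sub_apply, hconst, Function.const_apply]

lemma inner_flux (hk : Permeability k) (S : EPHL2 Ω) (G U : EPHL2Vec Ω) :
    inner ℝ (flux hk g S G) U = ∫ x in Ω, inner ℝ (k (S x) • (G x - g)) (U x) := by
  rw [L2.inner_def]
  refine integral_congr_ae ?_
  filter_upwards [coeFn_flux (g := g) hk S G] with x hx
  rw [hx]

end Flux

section Trajectories

variable {d : ℕ} {Ω : Set (EPHSpace d)} {T M τ : ℝ} {pcI pcD k b : ℝ → ℝ} {g : EPHSpace d}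
  {S₀ : EPHL2 Ω} {p₀ : H10 Ω} {p : L2Time T (H10 Ω)} {S u : ℝ → EPHL2 Ω}
  {dS : L2Time T (HMinus1 Ω)} {dv : L2Time T (EPHL2 Ω)}

lemma BoundedC1.memLp_compH10 {β : ℝ → ℝ} (h : BoundedC1 β M) (p : L2Time T (H10 Ω)) :
    MemLp (fun t => h.compH10 (p t)) 2 (timeMeasure T) :=
  (Lp.memLp p).of_le_mul (c := M)
    (h.continuous_compH10.comp_aestronglyMeasurable (Lp.aestronglyMeasurable p))
    (Eventually.of_forall fun _ => h.norm_compH10_le _)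

lemma setIntegral_play_eq {u v : ℝ → EPHL2 Ω} {U V : ℝ → EPHSpace d → ℝ}
    (hu : ∀ᵐ t ∂timeMeasure T, u t =ᵐ[volume.restrict Ω] U t)
    (hv : ∀ᵐ t ∂timeMeasure T, v t =ᵐ[volume.restrict Ω] V t)
    (hode : ∀ ξ : L2Time T (EPHL2 Ω), ∫ t in Ioc 0 T, ∫ x in Ω, dv t x * ξ t x
      = ∫ t in Ioc 0 T, ∫ x in Ω, PhiTau pcI pcD b τ (U t x) (V t x) * ξ t x)
    {ζ : ℝ → EPHL2 Ω} (hζ : MemLp ζ 2 (timeMeasure T)) {s : ℝ} (hs : s ≤ T) :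
    ∫ t in Ioc 0 s, inner ℝ (dv t) (ζ t)
      = ∫ t in Ioc 0 s, ∫ x in Ω, PhiTau pcI pcD b τ (u t x) (v t x) * ζ t x := by
  refine setIntegral_eq_of_forall_lp_two (f := fun t ξ => inner ℝ (dv t) ξ)
    (h := fun t ξ => ∫ x in Ω, PhiTau pcI pcD b τ (u t x) (v t x) * ξ x)
    (fun t => inner_zero_right _) (fun t => ?_) (fun ξ => ?_) hζ hs
  · refine integral_eq_zero_of_ae ?_
    filter_upwards [Lp.coeFn_zero ℝ 2 (volume.restrict Ω)] with x hx
    rw [hx, Pi.zero_apply, mul_zero]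
  · simp_rw [L2.inner_def, RCLike.inner_apply, conj_trivial, mul_comm (ξ _ _)]
    rw [hode ξ]
    refine integral_congr_ae ?_
    filter_upwards [hu, hv] with t hut hvt
    refine integral_congr_ae ?_
    filter_upwards [hut, hvt] with x hux hvx
    rw [hux, hvx]

variable [IsFiniteMeasure (volume.restrict Ω)]

/-- The model with regularisation parameter `τ` in terms of the representatives `S` and `u` of the
saturation and of `b(p)` in `C([0,T];L²(Ω))`; `dS` and `dv` are the time derivatives of `S` and of
`v = S + u`. The equations are tested on every interval `(0,s)`. -/
structure IsTrajectory (pcI pcD : ℝ → ℝ) (hk : Permeability k) (hM : BoundedC1 b M)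
    (g : EPHSpace d) (τ : ℝ) (p : L2Time T (H10 Ω)) (S u : ℝ → EPHL2 Ω)
    (dS : L2Time T (HMinus1 Ω)) (dv : L2Time T (EPHL2 Ω)) : Prop where
  continuousOn_saturation : ContinuousOn S (Icc 0 T)
  continuousOn_comp : ContinuousOn u (Icc 0 T)
  comp_eq : ∀ᵐ t ∂timeMeasure T, u t = hM.compL2 (H10.fn (p t))
  saturation_mem : ∀ᵐ t ∂timeMeasure T, ∀ᵐ x ∂volume.restrict Ω, S t x ∈ Icc 0 1
  hasDualDeriv_saturation : HasDualDeriv T (H10.fnL Ω) S dS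
  weak_deriv_add : ∀ η, IsTimeTest T η →
    ∫ t in Ioc 0 T, deriv η t • (S + u) t = -∫ t in Ioc 0 T, η t • dv t
  flux_eq : ∀ w : ℝ → H10 Ω, MemLp w 2 (timeMeasure T) → ∀ s ∈ Ioc 0 T,
    ∫ t in Ioc 0 s, dS t (w t)
      = ∫ t in Ioc 0 s, inner ℝ (flux hk g (S t) (H10.grad (p t))) (H10.grad (w t))
  play_eq : ∀ ζ : ℝ → EPHL2 Ω, MemLp ζ 2 (timeMeasure T) → ∀ s ∈ Ioc 0 T,
    ∫ t in Ioc 0 s, inner ℝ (dv t) (ζ t)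
      = ∫ t in Ioc 0 s, ∫ x in Ω, PhiTau pcI pcD b τ (u t x) ((S t + u t) x) * ζ t x

lemma setIntegral_flux_eq (hk : Permeability k) {σ : L2Time T (EPHL2 Ω)}
    (hS : ∀ᵐ t ∂timeMeasure T, S t = σ t)
    (hweak : ∀ φ : L2Time T (H10 Ω), ∫ t in Ioc 0 T, (dS t) (φ t)
      = ∫ t in Ioc 0 T, ∫ x in Ω,
          inner ℝ (k (σ t x) • (H10.grad (p t) x - g)) (H10.grad (φ t) x))
    {w : ℝ → H10 Ω} (hw : MemLp w 2 (timeMeasure T)) {s : ℝ} (hs : s ≤ T) :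
    ∫ t in Ioc 0 s, dS t (w t)
      = ∫ t in Ioc 0 s, inner ℝ (flux hk g (S t) (H10.grad (p t))) (H10.grad (w t)) := by
  simp_rw [← H10.gradL_apply]
  refine setIntegral_eq_of_forall_lp_two (f := fun t φ => dS t φ)
    (h := fun t φ => inner ℝ (flux hk g (S t) (H10.gradL Ω (p t))) (H10.gradL Ω φ))
    (fun t => map_zero _) (fun t => by rw [map_zero, inner_zero_right]) (fun φ => ?_) hw hs
  rw [hweak φ]
  refine integral_congr_ae ?_
  filter_upwards [hS] with t ht
  rw [ht, H10.gradL_apply, H10.gradL_apply, inner_flux]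

theorem IsEPHWeakSolution.exists_isTrajectory (hT : 0 < T) (hk : Permeability k)
    (hM : BoundedC1 b M) {σ : L2Time T (EPHL2 Ω)}
    (hsol : IsEPHWeakSolution pcI pcD k b g S₀ p₀ τ σ p) :
    ∃ (S u : ℝ → EPHL2 Ω) (dS : L2Time T (HMinus1 Ω)) (dv : L2Time T (EPHL2 Ω)),
      IsTrajectory pcI pcD hk hM g τ p S u dS dv ∧
        S 0 = S₀ ∧ u 0 = hM.compL2 (H10.fn p₀) := by
  obtain ⟨-, ⟨P, hP, hPp, hP0⟩, ⟨S, hS, hSσ, hS0⟩, hsat, ⟨Z, dS, hZ, hdS, hflux⟩,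
    ⟨v, dv, hv, hdv, hplay⟩⟩ := hsol
  set u : ℝ → EPHL2 Ω := fun t => hM.compL2 (P t) with hu
  have hup : ∀ᵐ t ∂timeMeasure T, u t = hM.compL2 (H10.fn (p t)) := by
    filter_upwards [hPp] with t ht
    rw [hu, ← ht]
  have hup' : ∀ᵐ t ∂timeMeasure T, u t =ᵐ[volume.restrict Ω] fun x => b (H10.fn (p t) x) := by
    filter_upwards [hup] with t ht
    rw [ht]
    exact hM.isNemytskii_compL2 _
  have hSu : ∀ᵐ t ∂timeMeasure T, S t + u t = v t := by
    filter_upwards [hSσ, hup', hv] with t hSt hut hvt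
    refine Lp.ext ?_
    filter_upwards [hut, hvt, Lp.coeFn_add (S t) (u t)] with x hux hvx hadd
    rw [hadd, Pi.add_apply, hSt, hux, hvx]
  refine ⟨S, u, dS, dv, ⟨hS, hM.continuous_compL2.comp_continuousOn hP, hup, ?_, ?_, ?_, ?_, ?_⟩,
    hS0, by rw [hu, ← hP0]⟩
  · filter_upwards [hSσ, hsat] with t hSt hsatt
    rwa [hSt]
  · refine .of_weak_sub hT hS ((Lp.memLp dS).integrable one_le_two) S₀ fun η hη φ => ?_
    rw [← hdS η hη φ]
    refine integral_congr_ae ?_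
    filter_upwards [hZ, hSσ] with t hZt hSt
    rw [hSt, hZt, H10.fnL_apply]
  · intro η hη
    rw [← hdv η hη]
    refine integral_congr_ae ?_
    filter_upwards [hSu] with t ht
    rw [Pi.add_apply, ht]
  · exact fun w hw s hs => setIntegral_flux_eq hk hSσ hflux hw hs.2
  · exact fun ζ hζ s hs =>
      setIntegral_play_eq hup' (hSu.mono fun t ht => by rw [ht]) hplay hζ hs.2

end Trajectories

section Entropy

variable {d : ℕ} {Ω : Set (EPHSpace d)} [IsFiniteMeasure (volume.restrict Ω)] {T M N τ : ℝ}
  {pcI pcD k b ψ : ℝ → ℝ} {g : EPHSpace d} {hk : Permeability k} {hM : BoundedC1 b M}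
  {p : L2Time T (H10 Ω)} {S u : ℝ → EPHL2 Ω} {dS : L2Time T (HMinus1 Ω)} {dv : L2Time T (EPHL2 Ω)}

lemma ScanningCurve.abs_comp_rho_le {pc : ℝ → ℝ} (h : ScanningCurve b pc) (hψ : BoundedC1 ψ N)
    (y : ℝ) : |ψ (rho b pc y)| ≤ N * max |b (pc 1)| |bInfty b| :=
  (hψ.abs_le _).trans (mul_le_mul_of_nonneg_left (h.abs_rho_le y) hψ.nonneg)

namespace IsTrajectory

variable (h : IsTrajectory pcI pcD hk hM g τ p S u dS dv)
include h

lemma continuousOn_add : ContinuousOn (S + u) (Icc 0 T) :=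
  h.continuousOn_saturation.add h.continuousOn_comp

lemma memLp_flux :
    MemLp (fun t => flux hk g (S t) (H10.grad (p t))) 2 (timeMeasure T) := by
  have hgrad : MemLp (fun t => H10.grad (p t) - Lp.const 2 _ g) 2 (timeMeasure T) :=
    ((H10.gradL Ω).comp_memLp' (Lp.memLp p)).sub (memLp_const _)
  have hS : AEStronglyMeasurable S (timeMeasure T) :=
    (h.continuousOn_saturation.mono Ioc_subset_Icc_self).aestronglyMeasurable measurableSet_Ioc
  exact hgrad.of_le_mul (c := k 1)
    ((continuous_bddCompSmul (E := EPHSpace d) hk.contDiff.continuous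
      hk.abs_le).comp_aestronglyMeasurable (hS.prodMk hgrad.1))
    (Eventually.of_forall fun t => norm_bddCompSmul_le _ _ _ _)

lemma memLp_bddComp_add {θ : ℝ → ℝ} {C : ℝ} (hθ : Continuous θ) (hC : ∀ x, |θ x| ≤ C) :
    MemLp (fun t => bddComp hθ hC ((S + u) t)) 2 (timeMeasure T) :=
  .of_bound (((continuous_bddComp hθ hC).comp_continuousOn
      (h.continuousOn_add.mono Ioc_subset_Icc_self)).aestronglyMeasurable measurableSet_Ioc) _
    (Eventually.of_forall fun _ => norm_bddCompSmul_le hθ hC _ _)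

lemma energy_comp_le (hT : 0 < T) (hψ : BoundedC1 ψ N) (hmono : Monotone ψ) {s : ℝ}
    (hs : s ∈ Ioc 0 T) :
    primitiveFunctional ψ 0 (u s) - primitiveFunctional ψ 0 (u 0)
      ≤ (∫ t in Ioc 0 s, inner ℝ (dv t) (H10.fn ((hψ.comp hM).compH10 (p t))))
        - ∫ t in Ioc 0 s, dS t ((hψ.comp hM).compH10 (p t)) := by
  have hN := isSubgradient_primitiveFunctional (μ := volume.restrict Ω) hmono
    hψ.contDiff.continuous hψ.isNemytskii_compL2 0
  have henergy := h.hasDualDeriv_saturation.convex_sub_le_integral_sub_integral hT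
    h.continuousOn_saturation h.continuousOn_add (Lp.memLp dS) (Lp.memLp dv) h.weak_deriv_add
    (hN.continuous hψ.continuous_compL2) hN ((hψ.comp hM).memLp_compH10 p)
    (h.comp_eq.mono fun t ht => by
      rw [add_sub_cancel_left, ht, H10.fnL_apply, BoundedC1.fn_compH10, hψ.compL2_comp hM]) hs
  rwa [add_sub_cancel_left] at henergy

lemma le_energy_add (hT : 0 < T) {θ : ℝ → ℝ} {C : ℝ} (hθ : Continuous θ) (hC : ∀ x, |θ x| ≤ C)
    (hanti : Antitone θ) (a : ℝ) {s : ℝ} (hs : s ∈ Ioc 0 T) :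
    ∫ t in Ioc 0 s, inner ℝ (dv t) (bddComp hθ hC ((S + u) t))
      ≤ primitiveFunctional θ a ((S + u) s) - primitiveFunctional θ a ((S + u) 0) := by
  have hderiv := HasDualDeriv.of_weak (j := .id ℝ (EPHL2 Ω)) hT h.continuousOn_add
    ((Lp.memLp dv).integrable one_le_two) h.weak_deriv_add
  have hN := isSubgradient_primitiveFunctional (μ := volume.restrict Ω) hanti.neg hθ.neg
    (isNemytskii_bddComp hθ hC).neg a
  have henergy := hderiv.convex_sub_le_integral hT.le h.continuousOn_add
    (memLp_dualMap _ (Lp.memLp dv)) (hN.continuous (continuous_bddComp hθ hC).neg) hN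
    (h.memLp_bddComp_add hθ hC).neg (Eventually.of_forall fun _ => rfl) hs
  simp only [dualMap_apply, ContinuousLinearMap.id_apply, Pi.neg_apply, inner_neg_right,
    integral_neg, primitiveFunctional_neg] at henergy
  linarith

lemma integral_inner_sub_nonpos (hloop : HysteresisLoop b pcI pcD) (hτ : 0 < τ)
    (hmono : Monotone ψ) {U R : ℝ → EPHL2 Ω} (hU : MemLp U 2 (timeMeasure T))
    (hR : MemLp R 2 (timeMeasure T))
    (hUψ : ∀ᵐ t ∂timeMeasure T, U t =ᵐ[volume.restrict Ω] fun x => ψ (u t x))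
    (hRψ : ∀ t, R t =ᵐ[volume.restrict Ω] fun x => ψ (rho b pcD ((S + u) t x))) {s : ℝ}
    (hs : s ∈ Ioc 0 T) :
    ∫ t in Ioc 0 s, inner ℝ (dv t) (U t - R t) ≤ 0 := by
  refine (h.play_eq _ (hU.sub hR) s hs).trans_le ?_
  refine integral_nonpos_of_ae ?_
  filter_upwards [ae_mono (Measure.restrict_mono (Ioc_subset_Ioc_right hs.2) le_rfl) hUψ]
    with t hUt
  refine integral_nonpos_of_ae ?_
  filter_upwards [hUt, hRψ t, Lp.coeFn_sub (U t) (R t)] with x hUx hRx hsub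
  rw [Pi.sub_apply, hsub, Pi.sub_apply, hUx, hRx]
  exact hloop.PhiTau_mul_nonpos hmono hτ _ _

/-- Testing the `v`-equation with `ψ(u) - ψ(ρ(v))`, `ρ` the drainage curve, makes the contribution
of `Φ_τ` nonpositive whatever `τ` is. -/
theorem entropy_inequality (hT : 0 < T) (hloop : HysteresisLoop b pcI pcD) (hτ : 0 < τ)
    (hψ : BoundedC1 ψ N) (hmono : Monotone ψ) (a : ℝ) {s : ℝ} (hs : s ∈ Ioc 0 T) :
    primitiveFunctional ψ 0 (u s) - primitiveFunctional ψ 0 (u 0)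
        + ∫ t in Ioc 0 s, inner ℝ (flux hk g (S t) (H10.grad (p t)))
            (H10.grad ((hψ.comp hM).compH10 (p t)))
      ≤ primitiveFunctional (fun y => ψ (rho b pcD y)) a ((S + u) s)
        - primitiveFunctional (fun y => ψ (rho b pcD y)) a ((S + u) 0) := by
  have hθ : Continuous fun y => ψ (rho b pcD y) :=
    hψ.contDiff.continuous.comp hloop.drainage.continuous_rho
  have hC := hloop.drainage.abs_comp_rho_le hψ
  have hanti : Antitone fun y => ψ (rho b pcD y) :=
    hmono.comp_antitone hloop.drainage.antitone_rho
  have hw := (hψ.comp hM).memLp_compH10 p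
  have hU : MemLp (fun t => H10.fn ((hψ.comp hM).compH10 (p t))) 2 (timeMeasure T) :=
    (H10.fnL Ω).comp_memLp' hw
  have hR := h.memLp_bddComp_add hθ hC
  have henergy_u := h.energy_comp_le hT hψ hmono hs
  have henergy_v := h.le_energy_add hT hθ hC hanti a hs
  have hplay := h.integral_inner_sub_nonpos hloop hτ hmono hU hR
    (h.comp_eq.mono fun t ht => by
      rw [ht, BoundedC1.fn_compH10, hψ.compL2_comp hM]
      exact hψ.isNemytskii_compL2 _)
    (fun t => isNemytskii_bddComp hθ hC _) hs
  have hle : volume.restrict (Ioc 0 s) ≤ timeMeasure T :=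
    Measure.restrict_mono (Ioc_subset_Ioc_right hs.2) le_rfl
  simp only [inner_sub_right] at hplay
  rw [integral_sub ((integrable_inner_of_memLp_two (Lp.memLp dv) hU).mono_measure hle)
    ((integrable_inner_of_memLp_two (Lp.memLp dv) hR).mono_measure hle)] at hplay
  rw [h.flux_eq _ hw s hs] at henergy_u
  linarith

end IsTrajectory

end Entropy

section InvariantRegion

lemma exists_truncation {K : ℝ} (hK : 0 ≤ K) :
    ∃ ψ : ℝ → ℝ, BoundedC1 ψ 1 ∧ Monotone ψ ∧ ∀ x, ψ x = 0 ↔ x ≤ K := by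
  set f : ℝ → ℝ := fun y => max 0 (min (y - K) 1) with hf
  have hcont : Continuous f := by fun_prop
  have hmono : Monotone f := fun x y hxy =>
    max_le_max le_rfl (min_le_min (sub_le_sub_right hxy K) le_rfl)
  have hf0 : ∀ x, f x = 0 ↔ x ≤ K := fun x => by simp [hf]
  have hbound : ∀ x, |f x| ≤ 1 := fun x => by
    rw [abs_of_nonneg (le_max_left _ _)]
    exact max_le zero_le_one (min_le_right _ _)
  refine ⟨fun x => ∫ y in (0 : ℝ)..x, f y, .of_integral hcont hbound, fun x y hxy => ?_,
    fun x => ?_⟩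
  · refine sub_nonneg.1 ?_
    rw [intervalIntegral.integral_interval_sub_left (hcont.intervalIntegrable _ _)
      (hcont.intervalIntegrable _ _)]
    exact intervalIntegral.integral_nonneg hxy fun z _ => le_max_left _ _
  · rw [integral_eq_zero_iff_of_monotone hmono hcont ((hf0 0).2 hK), hf0]

variable {d : ℕ} {Ω : Set (EPHSpace d)} {T M τ ε : ℝ} {pcI pcD k b : ℝ → ℝ}
  {p : L2Time T (H10 Ω)} {S u : ℝ → EPHL2 Ω} {dS : L2Time T (HMinus1 Ω)} {dv : L2Time T (EPHL2 Ω)}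

lemma HysteresisLoop.exists_saturation_barrier (h : HysteresisLoop b pcI pcD) (hε : 0 < ε) :
    ∃ s ∈ Ioo (0 : ℝ) 1, 0 ≤ pcD s ∧ ∀ S ∈ Icc ε 1, ∀ p ∈ Icc (pcI S) (pcD S),
      b p ≤ b (pcD s) ∧ s + b (pcD s) ≤ S + b p := by
  have hε' : min ε (1 / 2) ∈ Ioc (0 : ℝ) 1 :=
    ⟨lt_min hε one_half_pos, (min_le_right _ _).trans one_half_lt_one.le⟩
  obtain ⟨s, ⟨hv, hpc⟩, hs0, hsε⟩ :=
    (((h.drainage.tendsto_add_comp.eventually_lt_const (h.imbibition.bInfty_lt hε')).and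
      (h.drainage.blowup.eventually_ge_atTop 0)).and (Ioo_mem_nhdsGT hε'.1)).exists
  have hs1 : s < 1 := hsε.trans_le hε'.2
  refine ⟨s, ⟨hs0, hs1⟩, hpc, fun S hS p hp => ?_⟩
  have hεS : min ε (1 / 2) ≤ S := (min_le_left _ _).trans hS.1
  have hS' : S ∈ Ioc (0 : ℝ) 1 := ⟨hε.trans_le hS.1, hS.2⟩
  have hdrainage : b (pcD S) ≤ b (pcD s) :=
    h.drainage.strictAntiOn.antitoneOn ⟨hs0, hs1.le⟩ hS' (hsε.le.trans hεS)
  have himbibition : min ε (1 / 2) + b (pcI (min ε (1 / 2))) ≤ S + b (pcI S) :=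
    h.imbibition.strictMonoOn.monotoneOn hε' hS' hεS
  have hIp := h.imbibition.monotone hp.1
  exact ⟨(h.drainage.monotone hp.2).trans hdrainage, by linarith⟩

variable [IsFiniteMeasure (volume.restrict Ω)] {hk : Permeability k} {hM : BoundedC1 b M}

lemma inner_flux_zero_grad_compH10_nonneg (hk : Permeability k) {β : ℝ → ℝ} (hβ : BoundedC1 β M)
    (hmono : Monotone β) (S : EPHL2 Ω) (w : H10 Ω) :
    0 ≤ inner ℝ (flux hk 0 S (H10.grad w)) (H10.grad (hβ.compH10 w)) := by
  rw [inner_flux]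
  refine integral_nonneg_of_ae ?_
  filter_upwards [hβ.coeFn_grad_compH10 w] with x hx
  rw [hx, sub_zero, real_inner_smul_left, real_inner_smul_right]
  exact mul_nonneg (hk.nonneg_apply _) (mul_nonneg hmono.deriv_nonneg real_inner_self_nonneg)

lemma IsTrajectory.le_saturation (h : IsTrajectory pcI pcD hk hM 0 τ p S u dS dv) (hT : 0 < T)
    (hloop : HysteresisLoop b pcI pcD) (hτ : 0 < τ) {s : ℝ} (hs : s ∈ Ioo (0 : ℝ) 1)
    (hK : 0 ≤ b (pcD s)) (hu0 : ∀ᵐ x ∂volume.restrict Ω, u 0 x ≤ b (pcD s))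
    (hv0 : ∀ᵐ x ∂volume.restrict Ω, s + b (pcD s) ≤ (S + u) 0 x) {t : ℝ} (ht : t ∈ Ioc 0 T) :
    ∀ᵐ x ∂volume.restrict Ω, s ≤ S t x := by
  obtain ⟨ψ, hψ, hmono, hψ0⟩ := exists_truncation hK
  have hψu := primitiveFunctional_eq_zero_iff (μ := volume.restrict Ω) hmono
    hψ.contDiff.continuous hψ.isNemytskii_compL2 hψ.zero
  set θ : ℝ → ℝ := fun y => -ψ (rho b pcD y)
  have hθ0 : ∀ y, θ y = 0 ↔ s + b (pcD s) ≤ y := fun y => by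
    rw [neg_eq_zero, hψ0, hloop.drainage.rho_le_iff hs]
  have hθa : θ (s + b (pcD s)) = 0 := (hθ0 _).2 le_rfl
  have hθm : Monotone θ := (hmono.comp_antitone hloop.drainage.antitone_rho).neg
  have hρc := hψ.contDiff.continuous.comp hloop.drainage.continuous_rho
  have hθv := primitiveFunctional_eq_zero_iff (μ := volume.restrict Ω) hθm hρc.neg
    (isNemytskii_bddComp hρc (hloop.drainage.abs_comp_rho_le hψ)).neg hθa
  have hentropy := h.entropy_inequality hT hloop hτ hψ hmono (s + b (pcD s)) ht
  have hdiss : 0 ≤ ∫ r in Ioc 0 t, inner ℝ (flux hk 0 (S r) (H10.grad (p r)))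
      (H10.grad ((hψ.comp hM).compH10 (p r))) := integral_nonneg fun r =>
    inner_flux_zero_grad_compH10_nonneg hk (hψ.comp hM) (hmono.comp hloop.drainage.monotone)
      (S r) (p r)
  have hneg := primitiveFunctional_neg (μ := volume.restrict Ω) (fun y => ψ (rho b pcD y))
    (s + b (pcD s))
  rw [(hψu _).2 (hu0.mono fun x => (hψ0 _).2)] at hentropy
  have hinit := hneg ((S + u) 0)
  rw [(hθv _).2 (hv0.mono fun x => (hθ0 _).2)] at hinit
  have hψt := primitiveFunctional_nonneg hmono hψ.zero (u t)
  have hθt := primitiveFunctional_nonneg hθm hθa ((S + u) t)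
  filter_upwards [(hψu (u t)).1 (by linarith [hneg ((S + u) t)]),
    (hθv ((S + u) t)).1 (by linarith [hneg ((S + u) t)]), Lp.coeFn_add (S t) (u t)]
    with x hux hvx hadd
  rw [hψ0] at hux
  rw [hθ0, Pi.add_apply, hadd, Pi.add_apply] at hvx
  linarith

theorem exists_permeability_lower_bound {g : EPHSpace d} {S₀ : EPHL2 Ω} {p₀ : H10 Ω} (hT : 0 < T)
    (hloop : HysteresisLoop b pcI pcD) (hk : Permeability k) (hM : BoundedC1 b M)
    (hcase : 0 < k 0 ∨ g = 0) (hε : 0 < ε)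
    (hinit : ∀ᵐ x ∂volume.restrict Ω,
      S₀ x ∈ Icc ε 1 ∧ H10.fn p₀ x ∈ Icc (pcI (S₀ x)) (pcD (S₀ x))) :
    ∃ κ > 0, ∀ {τ : ℝ} {p : L2Time T (H10 Ω)} {S u : ℝ → EPHL2 Ω} {dS : L2Time T (HMinus1 Ω)}
      {dv : L2Time T (EPHL2 Ω)}, 0 < τ → IsTrajectory pcI pcD hk hM g τ p S u dS dv → S 0 = S₀ →
      u 0 = hM.compL2 (H10.fn p₀) →
        ∀ᵐ t ∂timeMeasure T, ∀ᵐ x ∂volume.restrict Ω, κ ≤ k (S t x) := by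
  rcases hcase with hk0 | rfl
  · exact ⟨k 0, hk0, fun _ _ _ _ => Eventually.of_forall fun _ => Eventually.of_forall fun _ =>
      (hk.mem_Icc _).1⟩
  obtain ⟨s, hs, hpc, hbarrier⟩ := hloop.exists_saturation_barrier hε
  obtain ⟨κ, hκ, hκS⟩ := hk.exists_pos_le hs
  have hK : 0 ≤ b (pcD s) := hM.zero.ge.trans (hloop.drainage.monotone hpc)
  refine ⟨κ, hκ, fun {τ p S u dS dv} hτ h hS0 hu0 => ?_⟩
  have hb := hM.isNemytskii_compL2 (H10.fn p₀)
  have hu : ∀ᵐ x ∂volume.restrict Ω, u 0 x ≤ b (pcD s) := by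
    filter_upwards [hinit, hb] with x hx hbx
    rw [hu0, hbx]
    exact (hbarrier _ hx.1 _ hx.2).1
  have hv : ∀ᵐ x ∂volume.restrict Ω, s + b (pcD s) ≤ (S + u) 0 x := by
    filter_upwards [hinit, hb, Lp.coeFn_add (S 0) (u 0)] with x hx hbx hadd
    rw [Pi.add_apply, hadd, Pi.add_apply, hS0, hu0, hbx]
    exact (hbarrier _ hx.1 _ hx.2).2
  filter_upwards [h.saturation_mem, ae_restrict_mem measurableSet_Ioc] with t ht htT
  filter_upwards [ht, h.le_saturation hT hloop hτ hs hK hu hv htT] with x hx hsx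
  exact hκS _ ⟨hsx, hx.2⟩

end InvariantRegion

section UniformBound

lemma setIntegral_Ioc_le_of_ae_le {T C : ℝ} (hT : 0 < T) {f : ℝ → ℝ}
    (hf : IntegrableOn f (Ioc 0 T)) (hC : ∀ᵐ s ∂timeMeasure T, ∫ t in Ioc 0 s, f t ≤ C) :
    ∫ t in Ioc 0 T, f t ≤ C := by
  have hprim : ContinuousOn (fun s => ∫ t in (0 : ℝ)..s, f t) (Icc 0 T) := by
    rw [← uIcc_of_le hT.le]
    refine intervalIntegral.continuousOn_primitive_interval ?_
    rwa [uIcc_of_le hT.le, integrableOn_Icc_iff_integrableOn_Ioc]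
  have hmin : EqOn (fun s => ∫ t in (0 : ℝ)..s, f t) (fun s => min (∫ t in (0 : ℝ)..s, f t) C)
      (Icc 0 T) := by
    refine Measure.eqOn_Icc_of_ae_eq volume hT.ne ?_ hprim (hprim.inf continuousOn_const)
    rw [← restrict_Ioc_eq_restrict_Icc]
    filter_upwards [hC, ae_restrict_mem measurableSet_Ioc] with s hs hsT
    rw [intervalIntegral.integral_of_le hsT.1.le, min_eq_left hs]
  rw [← intervalIntegral.integral_of_le hT.le]
  exact min_eq_left_iff.1 (hmin (right_mem_Icc.2 hT.le)).symm

lemma norm_smul_sq_le_inner_smul_sub_smul {E : Type*} [NormedAddCommGroup E]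
    [InnerProductSpace ℝ E] {κ k k₁ β M : ℝ} (hκ : 0 < κ) (hk : k ∈ Icc κ k₁) (hM : 0 < M)
    (hβ : β ∈ Icc 0 M) (G g : E) :
    κ / (2 * M) * ‖β • G‖ ^ 2 - k₁ ^ 2 * ‖g‖ ^ 2 * M / (2 * κ)
      ≤ inner ℝ (k • (G - g)) (β • G) := by
  have hk0 : 0 ≤ k := hκ.le.trans hk.1
  have hβ0 : 0 ≤ β := hβ.1
  have hquad : κ / M * ‖β • G‖ ^ 2 ≤ k * inner ℝ G (β • G) := by
    rw [norm_smul, real_inner_smul_right, real_inner_self_eq_norm_sq, Real.norm_of_nonneg hβ.1]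
    calc κ / M * (β * ‖G‖) ^ 2 = β / M * (κ * (β * ‖G‖ ^ 2)) := by ring
      _ ≤ 1 * (k * (β * ‖G‖ ^ 2)) := by
        gcongr
        exacts [(div_le_one hM).2 hβ.2, hk.1]
      _ = k * (β * ‖G‖ ^ 2) := one_mul _
  have hcross : k * inner ℝ g (β • G) ≤ k₁ * (‖g‖ * ‖β • G‖) :=
    (mul_le_mul_of_nonneg_left (real_inner_le_norm _ _) hk0).trans
      (mul_le_mul_of_nonneg_right hk.2 (by positivity))
  have hamgm : k₁ * (‖g‖ * ‖β • G‖)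
      ≤ κ / (2 * M) * ‖β • G‖ ^ 2 + k₁ ^ 2 * ‖g‖ ^ 2 * M / (2 * κ) := by
    refine sub_nonneg.1 (le_of_le_of_eq
      (by positivity : 0 ≤ κ / (2 * M) * (‖β • G‖ - k₁ * ‖g‖ * M / κ) ^ 2) ?_)
    field_simp
    ring
  have hhalf : κ / M = κ / (2 * M) + κ / (2 * M) := by ring
  rw [hhalf, add_mul] at hquad
  rw [real_inner_smul_left, inner_sub_left, mul_sub]
  linarith

variable {d : ℕ} {Ω : Set (EPHSpace d)} {T : ℝ}

lemma ae_norm_fn_le_sqrt_of_energy_le {u : L2Time T (H10 Ω)} {A c : ℝ} (hc : 0 < c)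
    (h : ∀ᵐ s ∂timeMeasure T,
      ‖H10.fn (u s)‖ ^ 2 / 4 + c * ∫ t in Ioc 0 s, ‖H10.grad (u t)‖ ^ 2 ≤ A) :
    ∀ᵐ t ∂timeMeasure T, ‖H10.fn (u t)‖ ≤ √(4 * A) := by
  filter_upwards [h] with s hs
  have hgrad : 0 ≤ c * ∫ t in Ioc 0 s, ‖H10.grad (u t)‖ ^ 2 := by positivity
  exact Real.le_sqrt_of_sq_le (by linarith)

lemma norm_le_sqrt_of_energy_le (hT : 0 < T) {u : L2Time T (H10 Ω)} {A c : ℝ} (hc : 0 < c)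
    (h : ∀ᵐ s ∂timeMeasure T,
      ‖H10.fn (u s)‖ ^ 2 / 4 + c * ∫ t in Ioc 0 s, ‖H10.grad (u t)‖ ^ 2 ≤ A) :
    ‖u‖ ≤ √(T * (4 * A) + A / c) := by
  have hfn_int : Integrable (fun t => ‖H10.fn (u t)‖ ^ 2) (timeMeasure T) :=
    ((H10.fnL Ω).comp_memLp' (Lp.memLp u)).integrable_norm_pow two_ne_zero
  have hgrad_int : Integrable (fun t => ‖H10.grad (u t)‖ ^ 2) (timeMeasure T) :=
    ((H10.gradL Ω).comp_memLp' (Lp.memLp u)).integrable_norm_pow two_ne_zero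
  have hfn : ∫ t in Ioc 0 T, ‖H10.fn (u t)‖ ^ 2 ≤ T * (4 * A) := by
    calc ∫ t in Ioc 0 T, ‖H10.fn (u t)‖ ^ 2 ≤ ∫ _ in Ioc 0 T, 4 * A := by
          refine integral_mono_ae hfn_int (integrable_const _) ?_
          filter_upwards [h] with s hs
          have hgrad : 0 ≤ c * ∫ t in Ioc 0 s, ‖H10.grad (u t)‖ ^ 2 := by positivity
          linarith
      _ = T * (4 * A) := by
          rw [setIntegral_const, Real.volume_real_Ioc_of_le hT.le, sub_zero, smul_eq_mul]
  have hgrad : ∫ t in Ioc 0 T, ‖H10.grad (u t)‖ ^ 2 ≤ A / c := by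
    refine setIntegral_Ioc_le_of_ae_le hT hgrad_int ?_
    filter_upwards [h] with s hs
    rw [le_div_iff₀' hc]
    linarith [sq_nonneg ‖H10.fn (u s)‖]
  refine Real.le_sqrt_of_sq_le ?_
  simp_rw [lp_two_norm_sq_eq_integral, H10.norm_sq]
  rw [integral_add hfn_int hgrad_int]
  exact add_le_add hfn hgrad

variable [IsFiniteMeasure (volume.restrict Ω)]

lemma norm_grad_compH10_sq_le_inner_flux {g : EPHSpace d} {k b : ℝ → ℝ} {M κ : ℝ}
    (hk : Permeability k) (hb : BoundedC1 b M) (hM : 0 < M) (hmono : Monotone b) (hκ : 0 < κ)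
    {S : EPHL2 Ω} (hS : ∀ᵐ x ∂volume.restrict Ω, κ ≤ k (S x)) (w : H10 Ω) :
    κ / (2 * M) * ‖H10.grad (hb.compH10 w)‖ ^ 2
        - volume.real Ω * (k 1 ^ 2 * ‖g‖ ^ 2 * M / (2 * κ))
      ≤ inner ℝ (flux hk g S (H10.grad w)) (H10.grad (hb.compH10 w)) := by
  have hgrad : Integrable (fun x => κ / (2 * M) * ‖H10.grad (hb.compH10 w) x‖ ^ 2)
    (volume.restrict Ω) := (lp_two_integrable_norm_sq _).const_mul _
  rw [L2.inner_def, lp_two_norm_sq_eq_integral, ← integral_const_mul, ← smul_eq_mul (volume.real Ω),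
    ← setIntegral_const, ← integral_sub hgrad (integrable_const _)]
  refine integral_mono_ae (hgrad.sub (integrable_const _)) (L2.integrable_inner _ _) ?_
  filter_upwards [hS, coeFn_flux (g := g) hk S (H10.grad w), hb.coeFn_grad_compH10 w]
    with x hx hflux hchain
  rw [hflux, hchain]
  exact norm_smul_sq_le_inner_smul_sub_smul hκ ⟨hx, (hk.mem_Icc _).2⟩ hM
    ⟨hmono.deriv_nonneg, (le_abs_self _).trans (hb.bound _)⟩ _ _

lemma primitiveFunctional_add_le_of_abs_le {θ : ℝ → ℝ} {C : ℝ} (hC : ∀ y, |θ y| ≤ C)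
    {S u : EPHL2 Ω} (hS : ∀ᵐ x ∂volume.restrict Ω, S x ∈ Icc 0 1)
    (hint : Integrable (fun x => ∫ y in (0 : ℝ)..(S + u) x, θ y) (volume.restrict Ω)) :
    primitiveFunctional θ 0 (S + u) ≤ volume.real Ω * (C + C ^ 2) + ‖u‖ ^ 2 / 4 := by
  have hu : Integrable (fun x => ‖u x‖ ^ 2 / 4) (volume.restrict Ω) :=
    (lp_two_integrable_norm_sq _).div_const _
  rw [lp_two_norm_sq_eq_integral, ← integral_div, ← smul_eq_mul (volume.real Ω),
    ← setIntegral_const, ← integral_add (integrable_const _) hu]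
  refine integral_mono_ae hint ((integrable_const _).add hu) ?_
  filter_upwards [hS, Lp.coeFn_add S u] with x hSx hadd
  have hprim : |∫ y in (0 : ℝ)..(S + u) x, θ y| ≤ C * |(S + u) x| := by
    simpa only [Real.norm_eq_abs, sub_zero] using
      intervalIntegral.norm_integral_le_of_norm_le_const (f := θ) (a := 0) (b := (S + u) x)
        fun y _ => hC y
  have hSu : |(S + u) x| ≤ 1 + ‖u x‖ := by
    rw [hadd, Pi.add_apply]
    exact (abs_add_le _ _).trans (add_le_add_left ((abs_of_nonneg hSx.1).trans_le hSx.2) _)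
  calc ∫ y in (0 : ℝ)..(S + u) x, θ y ≤ C * (1 + ‖u x‖) :=
        (le_abs_self _).trans (hprim.trans
          (mul_le_mul_of_nonneg_left hSu ((abs_nonneg _).trans (hC 0))))
    _ ≤ C + C ^ 2 + ‖u x‖ ^ 2 / 4 := by linarith [sq_nonneg (C - ‖u x‖ / 2)]

variable {pcI pcD k b : ℝ → ℝ} {g : EPHSpace d} {M κ τ : ℝ} {hk : Permeability k}
  {hM : BoundedC1 b M} {p : L2Time T (H10 Ω)} {S u : ℝ → EPHL2 Ω} {dS : L2Time T (HMinus1 Ω)}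
  {dv : L2Time T (EPHL2 Ω)}

lemma HysteresisLoop.primitiveFunctional_rho_add_le (h : HysteresisLoop b pcI pcD) {S u : EPHL2 Ω}
    (hS : ∀ᵐ x ∂volume.restrict Ω, S x ∈ Icc 0 1) :
    primitiveFunctional (rho b pcD) 0 (S + u)
      ≤ volume.real Ω * (max |b (pcD 1)| |bInfty b| + max |b (pcD 1)| |bInfty b| ^ 2)
        + ‖u‖ ^ 2 / 4 := by
  refine primitiveFunctional_add_le_of_abs_le h.drainage.abs_rho_le hS ?_
  have hint := integrable_primitive (μ := volume.restrict Ω) h.drainage.antitone_rho.neg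
    h.drainage.continuous_rho.neg
    (isNemytskii_bddComp h.drainage.continuous_rho h.drainage.abs_rho_le).neg 0 (S + u)
  exact hint.neg.congr (.of_forall fun x => by simp)

namespace IsTrajectory

variable (h : IsTrajectory pcI pcD hk hM g τ p S u dS dv)
include h

lemma setIntegral_norm_grad_sq_le (hM0 : 0 < M) (hmono : Monotone b) (hκ : 0 < κ)
    (hS : ∀ᵐ t ∂timeMeasure T, ∀ᵐ x ∂volume.restrict Ω, κ ≤ k (S t x)) {s : ℝ}
    (hs : s ∈ Ioc 0 T) :
    κ / (2 * M) * (∫ t in Ioc 0 s, ‖H10.grad (hM.compH10 (p t))‖ ^ 2)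
        - T * (volume.real Ω * (k 1 ^ 2 * ‖g‖ ^ 2 * M / (2 * κ)))
      ≤ ∫ t in Ioc 0 s, inner ℝ (flux hk g (S t) (H10.grad (p t)))
          (H10.grad (hM.compH10 (p t))) := by
  have hle : volume.restrict (Ioc 0 s) ≤ timeMeasure T :=
    Measure.restrict_mono (Ioc_subset_Ioc_right hs.2) le_rfl
  have hgrad : MemLp (fun t => H10.grad (hM.compH10 (p t))) 2 (timeMeasure T) :=
    (H10.gradL Ω).comp_memLp' (hM.memLp_compH10 p)
  have hsq := ((hgrad.integrable_norm_pow two_ne_zero).mono_measure hle).const_mul (κ / (2 * M))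
  have hflux := (integrable_inner_of_memLp_two h.memLp_flux hgrad).mono_measure hle
  have hdiss := integral_mono_ae (hsq.sub (integrable_const _)) hflux <| by
    filter_upwards [ae_mono hle hS] with t ht
    exact norm_grad_compH10_sq_le_inner_flux (g := g) hk hM hM0 hmono hκ ht (p t)
  simp only [Pi.sub_apply] at hdiss
  rw [integral_sub hsq (integrable_const _), integral_const_mul, setIntegral_const,
    Real.volume_real_Ioc_of_le hs.1.le, sub_zero, smul_eq_mul] at hdiss
  refine le_trans (sub_le_sub_left (mul_le_mul_of_nonneg_right hs.2 ?_) _) hdiss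
  positivity

/-- The quarter is what is left of the `1/2` in front of `‖u‖²` after the linear growth of the
primitive of `ρ` is absorbed. -/
lemma energy_bound (hT : 0 < T) (hloop : HysteresisLoop b pcI pcD) (hτ : 0 < τ) (hM0 : 0 < M)
    (hκ : 0 < κ) (hS : ∀ᵐ t ∂timeMeasure T, ∀ᵐ x ∂volume.restrict Ω, κ ≤ k (S t x)) :
    ∀ᵐ s ∂timeMeasure T,
      ‖H10.fn (hM.compH10 (p s))‖ ^ 2 / 4
          + κ / (2 * M) * ∫ t in Ioc 0 s, ‖H10.grad (hM.compH10 (p t))‖ ^ 2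
        ≤ ‖u 0‖ ^ 2 / 2 - primitiveFunctional (rho b pcD) 0 ((S + u) 0)
          + volume.real Ω * (max |b (pcD 1)| |bInfty b| + max |b (pcD 1)| |bInfty b| ^ 2)
          + T * (volume.real Ω * (k 1 ^ 2 * ‖g‖ ^ 2 * M / (2 * κ))) := by
  filter_upwards [h.comp_eq, h.saturation_mem, ae_restrict_mem measurableSet_Ioc] with s hu hSs hs
  have hentropy :
      primitiveFunctional (fun y => y) 0 (u s) - primitiveFunctional (fun y => y) 0 (u 0)
        + ∫ t in Ioc 0 s, inner ℝ (flux hk g (S t) (H10.grad (p t)))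
            (H10.grad (hM.compH10 (p t)))
      ≤ primitiveFunctional (rho b pcD) 0 ((S + u) s)
        - primitiveFunctional (rho b pcD) 0 ((S + u) 0) :=
    h.entropy_inequality hT hloop hτ .id monotone_id 0 hs
  have hdiss := h.setIntegral_norm_grad_sq_le hM0 hloop.drainage.monotone hκ hS hs
  have hρ := hloop.primitiveFunctional_rho_add_le (u := u s) hSs
  rw [primitiveFunctional_id, primitiveFunctional_id] at hentropy
  rw [hM.fn_compH10, ← hu]
  rw [Pi.add_apply] at hentropy
  linarith

end IsTrajectory

end UniformBound

section WeakConvergence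

theorem exists_subseq_forall_tendsto_apply {H : Type*} [NormedAddCommGroup H]
    [InnerProductSpace ℝ H] [CompleteSpace H] {x : ℕ → H} {C : ℝ} (hx : ∀ n, ‖x n‖ ≤ C) :
    ∃ (u : H) (θ : ℕ → ℕ), StrictMono θ ∧
      ∀ f : StrongDual ℝ H, Tendsto (fun n => f (x (θ n))) atTop (𝓝 (f u)) := by
  -- The sequential Banach–Alaoglu theorem needs separability, so work in the closed span of `x`.
  let K : Submodule ℝ H := (Submodule.span ℝ (range x)).topologicalClosure
  have : TopologicalSpace.SeparableSpace K :=
    (countable_range x).isSeparable.span.closure.separableSpace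
  have : CompleteSpace K := (Submodule.isClosed_topologicalClosure _).completeSpace_coe
  let y : ℕ → K := fun n =>
    ⟨x n, Submodule.le_topologicalClosure _ (Submodule.subset_span (mem_range_self n))⟩
  let dual := InnerProductSpace.toDual ℝ K
  obtain ⟨ℓ, -, θ, hθ, hlim⟩ := WeakDual.isSeqCompact_closedBall ℝ K 0 C
    (x := fun n => StrongDual.toWeakDual (dual (y n)))
    fun n => mem_closedBall_zero_iff.2 ((dual.norm_map (y n)).trans_le (hx n))
  refine ⟨dual.symm (WeakDual.toStrongDual ℓ), θ, hθ, fun f => ?_⟩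
  have hdual : ∀ v : K, f v = dual v (dual.symm (f.comp K.subtypeL)) := fun v => by
    rw [InnerProductSpace.toDual_apply_apply, real_inner_comm,
      InnerProductSpace.toDual_symm_apply, ContinuousLinearMap.comp_apply, Submodule.subtypeL_apply]
  rw [hdual, LinearIsometryEquiv.apply_symm_apply]
  refine (((WeakDual.eval_continuous _).tendsto ℓ).comp hlim).congr fun n => ?_
  exact (hdual (y (θ n))).symm

lemma mem_of_forall_tendsto_apply {E : Type*} [NormedAddCommGroup E] [NormedSpace ℝ E]
    {K : Set E} (hconv : Convex ℝ K) (hclosed : IsClosed K) {w : ℕ → E} {u : E}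
    (hw : ∀ n, w n ∈ K)
    (hlim : ∀ f : StrongDual ℝ E, Tendsto (fun n => f (w n)) atTop (𝓝 (f u))) : u ∈ K := by
  by_contra hu
  obtain ⟨f, c, hK, hfu⟩ := geometric_hahn_banach_closed_point hconv hclosed hu
  exact (le_of_tendsto' (hlim f) fun n => (hK _ (hw n)).le).not_gt hfu

variable {α E : Type*} {_ : MeasurableSpace α} {μ : Measure α} [NormedAddCommGroup E] {K : Set E}

lemma isClosed_setOf_ae_lp_mem {p : ℝ≥0∞} [Fact (1 ≤ p)] (hK : IsClosed K) :
    IsClosed {f : Lp E p μ | ∀ᵐ t ∂μ, f t ∈ K} := by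
  refine isClosed_of_closure_subset fun f hf => ?_
  obtain ⟨F, hF, hlim⟩ := mem_closure_iff_seq_limit.1 hf
  obtain ⟨θ, -, hθ⟩ := (tendstoInMeasure_of_tendsto_Lp hlim).exists_seq_tendsto_ae
  filter_upwards [hθ, ae_all_iff.2 hF] with t htends hmem
  exact hK.mem_of_tendsto htends (Eventually.of_forall fun n => hmem (θ n))

lemma convex_setOf_ae_lp_mem [NormedSpace ℝ E] {p : ℝ≥0∞} (hK : Convex ℝ K) :
    Convex ℝ {f : Lp E p μ | ∀ᵐ t ∂μ, f t ∈ K} := by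
  intro f hf g hg a c ha hc hac
  filter_upwards [hf, hg, Lp.coeFn_add (a • f) (c • g), Lp.coeFn_smul a f, Lp.coeFn_smul c g]
    with t hft hgt hadd hsmul_f hsmul_g
  rw [hadd, Pi.add_apply, hsmul_f, hsmul_g]
  exact hK hft hgt ha hc hac

lemma ae_mem_of_forall_tendsto_apply [NormedSpace ℝ E] {p : ℝ≥0∞} [Fact (1 ≤ p)]
    (hconv : Convex ℝ K) (hclosed : IsClosed K) {w : ℕ → Lp E p μ} {u : Lp E p μ}
    (hw : ∀ n, ∀ᵐ t ∂μ, w n t ∈ K)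
    (hlim : ∀ f : StrongDual ℝ (Lp E p μ), Tendsto (fun n => f (w n)) atTop (𝓝 (f u))) :
    ∀ᵐ t ∂μ, u t ∈ K :=
  mem_of_forall_tendsto_apply (K := {f : Lp E p μ | ∀ᵐ t ∂μ, f t ∈ K})
    (convex_setOf_ae_lp_mem hconv) (isClosed_setOf_ae_lp_mem hclosed) hw hlim

end WeakConvergence

section Main

variable {d : ℕ} {Ω : Set (EPHSpace d)} {T M : ℝ} {pcI pcD k b : ℝ → ℝ} {g : EPHSpace d}
  {S₀ : EPHL2 Ω} {p₀ : H10 Ω}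

instance H10.completeSpace : CompleteSpace (H10 Ω) :=
  (Submodule.isClosed_topologicalClosure _).completeSpace_coe

lemma HysteresisLoop.bound_pos (h : HysteresisLoop b pcI pcD) (hM : BoundedC1 b M) : 0 < M := by
  refine hM.nonneg.lt_of_ne fun hM0 => ?_
  have hconst : ∀ y, b y = 0 := fun y =>
    abs_nonpos_iff.1 ((hM.abs_le y).trans_eq (by rw [← hM0, zero_mul]))
  have hhalf : (1 / 2 : ℝ) ∈ Ioc 0 1 := by norm_num
  have hlt := h.drainage.strictAntiOn hhalf (right_mem_Ioc.2 one_pos) (by norm_num)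
  simp [hconst] at hlt

lemma isBOf_toLp_compH10 (hM : BoundedC1 b M) (p : L2Time T (H10 Ω)) :
    IsBOf b p ((hM.memLp_compH10 p).toLp _) := by
  filter_upwards [(hM.memLp_compH10 p).coeFn_toLp] with t ht
  rw [ht]
  exact hM.coeFn_fn_compH10 _

lemma IsBOf.ae_eq_compH10 (hΩ : IsOpen Ω) (hM : BoundedC1 b M) {p u : L2Time T (H10 Ω)}
    (h : IsBOf b p u) : u =ᵐ[timeMeasure T] fun t => hM.compH10 (p t) := by
  filter_upwards [h] with t ht
  exact H10.fn_injective hΩ (Lp.ext (EventuallyEq.trans ht (hM.coeFn_fn_compH10 (p t)).symm))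

variable [IsFiniteMeasure (volume.restrict Ω)]

theorem exists_energy_bound (hΩ : IsOpen Ω) (hT : 0 < T) (hloop : HysteresisLoop b pcI pcD)
    (hk : Permeability k) (hM : BoundedC1 b M) (hcase : 0 < k 0 ∨ g = 0) {ε : ℝ} (hε : 0 < ε)
    (hinit : ∀ᵐ x ∂volume.restrict Ω,
      S₀ x ∈ Icc ε 1 ∧ H10.fn p₀ x ∈ Icc (pcI (S₀ x)) (pcD (S₀ x))) :
    ∃ A, ∃ c > 0, ∀ τ > 0, ∀ (S : L2Time T (EPHL2 Ω)) (p u : L2Time T (H10 Ω)),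
      IsEPHWeakSolution pcI pcD k b g S₀ p₀ τ S p → IsBOf b p u → ∀ᵐ s ∂timeMeasure T,
        ‖H10.fn (u s)‖ ^ 2 / 4 + c * ∫ t in Ioc 0 s, ‖H10.grad (u t)‖ ^ 2 ≤ A := by
  obtain ⟨κ, hκ, hκS⟩ := exists_permeability_lower_bound hT hloop hk hM hcase hε hinit
  have hM0 := hloop.bound_pos hM
  refine ⟨‖hM.compL2 (H10.fn p₀)‖ ^ 2 / 2
      - primitiveFunctional (rho b pcD) 0 (S₀ + hM.compL2 (H10.fn p₀))
      + volume.real Ω * (max |b (pcD 1)| |bInfty b| + max |b (pcD 1)| |bInfty b| ^ 2)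
      + T * (volume.real Ω * (k 1 ^ 2 * ‖g‖ ^ 2 * M / (2 * κ))),
    κ / (2 * M), by positivity, fun τ hτ S p u hsol hu => ?_⟩
  obtain ⟨S, u', dS, dv, h, hS0, hu0⟩ := hsol.exists_isTrajectory hT hk hM
  have henergy := h.energy_bound hT hloop hτ hM0 hκ (hκS hτ h hS0 hu0)
  simp only [Pi.add_apply, hS0, hu0] at henergy
  have hup := hu.ae_eq_compH10 hΩ hM
  filter_upwards [henergy, hup, ae_restrict_mem measurableSet_Ioc] with s hs hus hsT
  have hgrad : ∫ t in Ioc 0 s, ‖H10.grad (u t)‖ ^ 2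
      = ∫ t in Ioc 0 s, ‖H10.grad (hM.compH10 (p t))‖ ^ 2 := by
    refine integral_congr_ae ?_
    filter_upwards [ae_mono (Measure.restrict_mono (Ioc_subset_Ioc_right hsT.2) le_rfl) hup]
      with t ht
    rw [ht]
  rwa [hus, hgrad]

theorem exists_uniform_bound (hΩ : IsOpen Ω) (hT : 0 < T) (hloop : HysteresisLoop b pcI pcD)
    (hk : Permeability k) (hM : BoundedC1 b M) (hcase : 0 < k 0 ∨ g = 0) {ε : ℝ} (hε : 0 < ε)
    (hinit : ∀ᵐ x ∂volume.restrict Ω,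
      S₀ x ∈ Icc ε 1 ∧ H10.fn p₀ x ∈ Icc (pcI (S₀ x)) (pcD (S₀ x))) :
    ∃ C, ∀ τ > 0, ∀ (S : L2Time T (EPHL2 Ω)) (p u : L2Time T (H10 Ω)),
      IsEPHWeakSolution pcI pcD k b g S₀ p₀ τ S p → IsBOf b p u →
        ‖u‖ ≤ C ∧ ∀ᵐ t ∂timeMeasure T, ‖H10.fn (u t)‖ ≤ C := by
  obtain ⟨A, c, hc, hA⟩ := exists_energy_bound hΩ hT hloop hk hM hcase hε hinit
  refine ⟨max √(T * (4 * A) + A / c) √(4 * A), fun τ hτ S p u hsol hu => ?_⟩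
  have henergy := hA τ hτ S p u hsol hu
  exact ⟨(norm_le_sqrt_of_energy_le hT hc henergy).trans (le_max_left _ _),
    (ae_norm_fn_le_sqrt_of_energy_le hc henergy).mono fun t ht => ht.trans (le_max_right _ _)⟩

theorem mainTheorem5_general (hΩ : IsOpen Ω) (hT : 0 < T) (hloop : HysteresisLoop b pcI pcD)
    (hk : Permeability k) (hM : BoundedC1 b M) (hcase : 0 < k 0 ∨ g = 0) {ε : ℝ} (hε : 0 < ε)
    (hinit : ∀ᵐ x ∂volume.restrict Ω,
      S₀ x ∈ Icc ε 1 ∧ H10.fn p₀ x ∈ Icc (pcI (S₀ x)) (pcD (S₀ x))) :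
    (∃ C : ℝ, ∀ τ : ℝ, 0 < τ → ∀ (S : L2Time T (EPHL2 Ω)) (p : L2Time T (H10 Ω)),
      IsEPHWeakSolution pcI pcD k b g S₀ p₀ τ S p →
      ∃ u : L2Time T (H10 Ω), IsBOf b p u ∧ ‖u‖ ≤ C ∧
        eLpNorm (fun t => H10.fn (u t)) ∞ (timeMeasure T) ≤ ENNReal.ofReal C) ∧
    ∀ (τ : ℕ → ℝ) (S : ℕ → L2Time T (EPHL2 Ω)) (p uτ : ℕ → L2Time T (H10 Ω)),
      (∀ n, 0 < τ n) →
      (∀ n, IsEPHWeakSolution pcI pcD k b g S₀ p₀ (τ n) (S n) (p n)) →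
      (∀ n, IsBOf b (p n) (uτ n)) →
      ∃ (u : L2Time T (H10 Ω)) (θ : ℕ → ℕ), StrictMono θ ∧
        MemLp (fun t => H10.fn (u t)) ∞ (timeMeasure T) ∧
        ∀ f : StrongDual ℝ (L2Time T (H10 Ω)),
          Tendsto (fun n => f (uτ (θ n))) atTop (𝓝 (f u)) := by
  obtain ⟨C, hC⟩ := exists_uniform_bound hΩ hT hloop hk hM hcase hε hinit
  refine ⟨⟨C, fun τ hτ S p hsol => ?_⟩, fun τ S p uτ hτ hsol hu => ?_⟩
  · obtain ⟨hnorm, hsup⟩ := hC τ hτ S p _ hsol (isBOf_toLp_compH10 hM p)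
    refine ⟨_, isBOf_toLp_compH10 hM p, hnorm, ?_⟩
    rw [eLpNorm_exponent_top]
    exact eLpNormEssSup_le_of_ae_bound hsup
  · have hbound := fun n => hC (τ n) (hτ n) (S n) (p n) (uτ n) (hsol n) (hu n)
    obtain ⟨u, θ, hθ, hlim⟩ := exists_subseq_forall_tendsto_apply (H := L2Time T (H10 Ω))
      fun n => (hbound n).1
    let K : Set (H10 Ω) := H10.fnL Ω ⁻¹' Metric.closedBall 0 C
    have hK : IsClosed K := Metric.isClosed_closedBall.preimage (H10.fnL Ω).continuous
    have hKconv : Convex ℝ K := (convex_closedBall 0 C).linear_preimage (H10.fnL Ω).toLinearMap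
    have huK := ae_mem_of_forall_tendsto_apply hKconv hK
      (fun n => (hbound (θ n)).2.mono fun t ht => mem_closedBall_zero_iff.2 ht) hlim
    exact ⟨u, θ, hθ, memLp_top_of_bound ((H10.fnL Ω).continuous.comp_aestronglyMeasurable
      (Lp.aestronglyMeasurable u)) C (huK.mono fun t ht => mem_closedBall_zero_iff.1 ht), hlim⟩

end Main

end

theorem mainTheorem5 {d : ℕ} (hd : 0 < d) (Ω : Set (EPHSpace d)) (hΩ : IsOpen Ω)
    (hΩb : Bornology.IsBounded Ω) (T : ℝ) (hT : 0 < T)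
    (pcI pcD k b : ℝ → ℝ) (g : EPHSpace d) (S₀ : EPHL2 Ω) (p₀ : H10 Ω)
    (hpc : CapillaryCurves pcI pcD) (hk : Permeability k) (hb : ScanningFunction pcI pcD b)
    (hini : InitialData pcI pcD S₀ p₀) (hcase : 0 < k 0 ∨ g = 0) :
    (∃ C : ℝ, ∀ τ : ℝ, 0 < τ → ∀ (S : L2Time T (EPHL2 Ω)) (p : L2Time T (H10 Ω)),
      IsEPHWeakSolution pcI pcD k b g S₀ p₀ τ S p →
      ∃ u : L2Time T (H10 Ω), IsBOf b p u ∧ ‖u‖ ≤ C ∧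
        eLpNorm (fun t => H10.fn (u t)) ∞ (timeMeasure T) ≤ ENNReal.ofReal C) ∧
    (∀ (τ : ℕ → ℝ) (S : ℕ → L2Time T (EPHL2 Ω)) (p uτ : ℕ → L2Time T (H10 Ω)),
      (∀ n, 0 < τ n) → Tendsto τ atTop (𝓝 0) →
      (∀ n, IsEPHWeakSolution pcI pcD k b g S₀ p₀ (τ n) (S n) (p n)) →
      (∀ n, IsBOf b (p n) (uτ n)) →
      ∃ (u : L2Time T (H10 Ω)) (θ : ℕ → ℕ), StrictMono θ ∧
        MemLp (fun t => H10.fn (u t)) ∞ (timeMeasure T) ∧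
        ∀ f : StrongDual ℝ (L2Time T (H10 Ω)),
          Tendsto (fun n => f (uτ (θ n))) atTop (𝓝 (f u))) := by
  have : IsFiniteMeasure (volume.restrict Ω) := isFiniteMeasure_restrict.2 hΩb.measure_lt_top.ne
  obtain ⟨M, hbM⟩ := hb.deriv_bdd
  have hM : BoundedC1 b M :=
    ⟨hb.contDiff, hb.zero, fun x => (abs_of_nonneg (hb.deriv_nonneg x)).trans_le (hbM x)⟩
  obtain ⟨ε, hε, haway⟩ := hini.away
  have hinit : ∀ᵐ x ∂volume.restrict Ω,
      S₀ x ∈ Icc ε 1 ∧ H10.fn p₀ x ∈ Icc (pcI (S₀ x)) (pcD (S₀ x)) := by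
    filter_upwards [haway, hini.between] with x hx hp
    exact ⟨⟨hx.1, hx.2.trans (sub_le_self 1 hε.le)⟩, hp⟩
  obtain ⟨hbound, hlimit⟩ :=
    mainTheorem5_general hΩ hT (.of_capillaryCurves hpc hb) hk hM hcase hε hinit
  exact ⟨hbound, fun τ S p uτ hτ _ hsol hu => hlimit τ S p uτ hτ hsol hu⟩
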